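/- Conventions: $\mathbb N=\{1,2,\dots\}$; $r'$ is the Hölder conjugate of $r\in[1,\infty]$, $\frac1r+\frac1{r'}=1$ (so $1'=\infty$); $(\Omega,\mathcal A,\mathbb P)$ is a probability space; $L^q(\Omega;E)$ is the Bochner space. A Rademacher family is a family of independent random variables $r_j$ with $\mathbb P(r_j=1)=\mathbb P(r_j=-1)=\frac12$. A real Banach space $E$ is of (Rademacher) type $p\in[1,2]$ if there is $\tau\in(0,\infty)$ such that $\bigl\|\sum_{j=1}^n r_jx_j\bigr\|_{L^p(\widetilde\Omega;E)}\le\tau\bigl(\sum_{j=1}^n\|x_j\|_E^p\bigr)^{1/p}$ for every Rademacher family on any probability space $\widetilde\Omega$, all $n\in\mathbb N$ and all $x_1,\dots,x_n\in E$; the infimum of such $\tau$ is the type $p$ constant $\tau_p(E)$. (A finite-dimensional space has every type $r\in[1,2]$.) **Theorem.** Let $p\in[1,2]$, let $E$ be a real Banach space of type $p$, and let $E_1\subseteq E_2\subseteq\dots\subseteq E$ be nested subspaces of finite dimension $N_\ell:=\dim E_\ell$. Suppose that there are $a_0,a_1\in[0,\infty)$ and $C_\tau\in[1,\infty)$ with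 $$\sup_{\ell\in\mathbb N}\ \sup_{r\in[p,2]\cap(1,2]} N_\ell^{-(a_0-a_1r')}\,[\tau_r(E_\ell)]^{r'}\le C_\tau .$$ Let $X\in L^1(\Omega;E)$, $q\in(1,\infty)\cap[p,\infty)$, $\bar q:=\min\{q,2\}$; for $\ell\in\mathbb N$ let $X_\ell\in L^q(\Omega;E_\ell)$, put $X_0:=0$ and $\xi_\ell:=X_\ell-X_{\ell-1}$, and let $\mathcal C_\ell\in[0,\infty)$ be the cost of generating one sample of $\xi_\ell$. Suppose that there are $\alpha,\beta,\gamma,C_\alpha,C_\beta,C_\gamma,c_1,c_2\in(0,\infty)$ and $A\in(1,\infty)$ such that, for all $\ell\in\mathbb N$, $c_1A^\ell\le N_\ell\le c_2A^\ell$ and $$\|\mathbb E[X]-\mathbb E[X_\ell]\|_E\le C_\alpha N_\ell^{-\alpha},\qquad \bigl\|X_\ell-\mathbb E[X_\ell]-(X_{\ell-1}-\mathbb E[X_{\ell-1}])\bigr\|_{L^q(\Omega;E)}\le C_\beta N_\ell^{-\beta},\qquad \mathcal C_\ell\le C_\gamma N_\ell^{\gamma}.$$ For each $\ell\in\mathbb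 N$ let $(\xi_{\ell,j})_{j\in\mathbb N}$ be a sequence of independent copies of $\xi_\ell$. Set $t:=\frac{\gamma+a_0}{\beta+a_1}$. Then there is a constant $K\in(0,\infty)$, depending only on $p,q,\alpha,\beta,\gamma,a_0,a_1,A,C_\tau,C_\alpha,C_\beta,C_\gamma,c_1,c_2$, such that for every $\epsilon\in(0,\frac12]$ there exist $L\in\mathbb N$ and $M_1,\dots,M_L\in\mathbb N$ with $$\Bigl\|\mathbb E[X]-\sum_{\ell=1}^L\frac1{M_\ell}\sum_{j=1}^{M_\ell}\xi_{\ell,j}\Bigr\|_{L^q(\Omega;E)}<\epsilon$$ and with total cost $$\sum_{\ell=1}^L M_\ell\,\mathcal C_\ell\ \le\ K\cdot\begin{cases} \epsilon^{-\frac\gamma\alpha}+\epsilon^{-\bar q'} & \text{if } t<\bar q',\\ \epsilon^{-\frac\gamma\alpha}+\epsilon^{-\bar q'}|\log_A\epsilon|^{\bar q'+1} & \text{if } t=\bar q',\\ \epsilon^{-\frac\gamma\alpha}+\epsilon^{-\bar q'-\frac{\gamma+a_0-(\beta+a_1)\bar q'}{\alpha}} & \text{if } t\in(\bar q',p'] \text{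 and } \alpha\ge\beta+a_1,\\ \epsilon^{-\frac\gamma\alpha}+\epsilon^{-t}|\log_A\epsilon|^{t+1} & \text{if } t\in(\bar q',p'] \text{ and } \alpha<\beta+a_1,\\ \epsilon^{-\frac\gamma\alpha}+\epsilon^{-\bar q'-\frac{\gamma+a_0-(\beta+a_1)\bar q'}{\alpha}} & \text{if } t>p' \text{ and } \alpha\ge\beta+a_1,\\ \epsilon^{-\frac\gamma\alpha}+\epsilon^{-p'-\frac{\gamma+a_0-(\beta+a_1)p'}{\alpha}} & \text{if } t>p' \text{ and } \alpha<\beta+a_1, \end{cases}$$ where for $p=1$ the condition $t\le p'=\infty$ always holds. -/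

import Mathlib

open MeasureTheory ProbabilityTheory
open scoped NNReal ENNReal

/-- A Rademacher family: independent random variables, each taking the values `1` and `-1`
with probability `1/2`. -/
structure IsRademacherFamily {ι Ω : Type*} [MeasurableSpace Ω] (P : Measure Ω)
    (r : ι → Ω → ℝ) : Prop where
  measurable : ∀ j, Measurable (r j)
  values : ∀ j ω, r j ω = 1 ∨ r j ω = -1
  indep : iIndepFun r P
  prob_one : ∀ j, P {ω | r j ω = 1} = 1 / 2
  prob_neg_one : ∀ j, P {ω | r j ω = -1} = 1 / 2

/-- `E` satisfies the type `p` inequality with constant `τ`: for every Rademacher family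
`r₁, …, rₙ` and all vectors `x₁, …, xₙ`,
`‖∑ rⱼ xⱼ‖_{L^p} ≤ τ (∑ ‖xⱼ‖^p)^{1/p}`.
All Rademacher families of length `n` have the same joint law, so the universe of the underlying
probability space is immaterial. -/
def RademacherTypeIneq (E : Type*) [NormedAddCommGroup E] [NormedSpace ℝ E]
    (p : ℝ) (τ : ℝ≥0) : Prop :=
  ∀ (Ω : Type) [MeasurableSpace Ω] (P : Measure Ω) [IsProbabilityMeasure P]
    (n : ℕ) (r : Fin n → Ω → ℝ), IsRademacherFamily P r → ∀ x : Fin n → E,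
      eLpNorm (fun ω => ∑ j, r j ω • x j) (ENNReal.ofReal p) P
        ≤ τ * (∑ j, ‖x j‖ₑ ^ p) ^ (1 / p)

/-- `E` is of Rademacher type `p`. -/
def HasRademacherType (E : Type*) [NormedAddCommGroup E] [NormedSpace ℝ E] (p : ℝ) : Prop :=
  ∃ τ : ℝ≥0, 0 < τ ∧ RademacherTypeIneq E p τ

/-- The type `p` constant `τ_p(E)`, the least admissible constant in the type `p` inequality
(with value `∞` if `E` is not of type `p`). -/
noncomputable def rademacherTypeConst (E : Type*) [NormedAddCommGroup E] [NormedSpace ℝ E]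
    (p : ℝ) : ℝ≥0∞ :=
  ⨅ (τ : ℝ≥0) (_ : 0 < τ ∧ RademacherTypeIneq E p τ), (τ : ℝ≥0∞)

/-- Growth of the type constants of the subspaces `V ℓ`, `ℓ ≥ 1`, of dimension `N_ℓ`:
`N_ℓ^{-(a₀ - a₁ r')} τ_r(V ℓ)^{r'} ≤ Cτ` for all `ℓ ≥ 1` and `r ∈ [p, 2] ∩ (1, 2]`. -/
def TypeConstGrowth {E : Type*} [NormedAddCommGroup E] [NormedSpace ℝ E]
    (V : ℕ → Submodule ℝ E) (p a₀ a₁ Cτ : ℝ) : Prop :=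
  ∀ ℓ : ℕ, 1 ≤ ℓ → ∀ r : ℝ, r ∈ Set.Icc p 2 ∩ Set.Ioc 1 2 →
    (Module.finrank ℝ (V ℓ) : ℝ≥0∞) ^ (-(a₀ - a₁ * r.conjExponent))
      * rademacherTypeConst (V ℓ) r ^ r.conjExponent ≤ ENNReal.ofReal Cτ

/-- The multilevel Monte Carlo estimator
`∑_{ℓ=1}^L (1 / M_ℓ) ∑_{j=1}^{M_ℓ} ξ_{ℓ,j}` (samples are numbered from `j = 0`). -/
noncomputable def mlmcEstimator {Ω E : Type*} [NormedAddCommGroup E] [NormedSpace ℝ E]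
    (ξ : ℕ → ℕ → Ω → E) (L : ℕ) (M : ℕ → ℕ) (ω : Ω) : E :=
  ∑ ℓ ∈ Finset.Icc 1 L, (1 / (M ℓ : ℝ)) • ∑ j ∈ Finset.range (M ℓ), ξ ℓ j ω

/-- The cost of the multilevel estimator when one sample on level `ℓ` costs `cost ℓ`. -/
noncomputable def mlmcCost (cost : ℕ → ℝ≥0) (L : ℕ) (M : ℕ → ℕ) : ℝ :=
  ∑ ℓ ∈ Finset.Icc 1 L, (M ℓ : ℝ) * (cost ℓ : ℝ)

/-- The six-case cost rate, with `t = (γ + a₀) / (β + a₁)`, `q̄ = min q 2` and `'` denoting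
Hölder conjugates. Since `1' = ∞`, the condition `t ≤ p'` reads `p = 1 ∨ t ≤ p / (p - 1)`. -/
noncomputable def mlmcRate (p q α β γ a₀ a₁ A ε : ℝ) : ℝ :=
  let t : ℝ := (γ + a₀) / (β + a₁)
  let q' : ℝ := (min q 2).conjExponent
  let p' : ℝ := p.conjExponent
  if t < q' then
    ε ^ (-(γ / α)) + ε ^ (-q')
  else if t = q' then
    ε ^ (-(γ / α)) + ε ^ (-q') * |Real.logb A ε| ^ (q' + 1)
  else if p = 1 ∨ t ≤ p' then
    if β + a₁ ≤ α then
      ε ^ (-(γ / α)) + ε ^ (-q' - (γ + a₀ - (β + a₁) * q') / α)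
    else
      ε ^ (-(γ / α)) + ε ^ (-t) * |Real.logb A ε| ^ (t + 1)
  else
    if β + a₁ ≤ α then
      ε ^ (-(γ / α)) + ε ^ (-q' - (γ + a₀ - (β + a₁) * q') / α)
    else
      ε ^ (-(γ / α)) + ε ^ (-p' - (γ + a₀ - (β + a₁) * p') / α)

/-! Fix `r` with `p ≤ r ≤ min q 2` and `r > 1`, and let `s = r'`, `b = β + a₁`. In a space
satisfying the type `r` inequality with constant `τ`, the mean of `M` independent copies of a
variable with centered `L^q` norm `D` has `L^q` error of order `τ D M^(-1/s)`. The growth condition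
bounds `τ` on level `ℓ` by a multiple of `N_ℓ^(a₀/s - a₁)`, so level `ℓ` contributes about
`A^(ℓ(a₀/s - b)) M_ℓ^(-1/s)` to the error, and the bias is about `A^(-αL)`.

The sampling estimate has two halves. For fixed vectors, bounded differences give the norm of a
Rademacher sum an exponential moment around its mean; the type inequality controls the mean, and the
`q`-th moment follows (`RademacherTypeIneq.cubeAvg_rpow_le`). For independent centered variables,
inserting any signs costs a factor 2; averaging over all signs and applying the first half pointwise
gives `RademacherTypeIneq.eLpNorm_sum_le`.

The rest is optimization. Take `A^L` of order `ε^(-1/α)` and give level `ℓ` the share `w_ℓ` of the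
error. The cost is then of order `ε^(-γ/α) + ε^(-s) ∑ A^(ℓ(γ + a₀ - bs)) w_ℓ^(-s)`. According to the
sign of `γ + a₀ - bs = b(t - s)`, the weights decay away from the coarse end, are uniform, or decay
away from the fine end. The six cases arise from the best `s`: it is `t` or `p'` if `t > q̄'` and `α
< b`, and `q̄'` otherwise. -/

/-! ### Averages over the sign cube -/

/-- The sign `±1` encoded by a Boolean. -/
def boolSign (b : Bool) : ℝ := if b then 1 else -1

lemma boolSign_eq (b : Bool) : boolSign b = 1 ∨ boolSign b = -1 := by
  cases b <;> simp [boolSign]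

lemma abs_boolSign (b : Bool) : |boolSign b| = 1 := by
  cases b <;> simp [boolSign]

/-- The average of a function over the cube `{±1}ⁿ`. -/
noncomputable def cubeAvg {n : ℕ} (f : (Fin n → Bool) → ℝ) : ℝ := (1 / 2) ^ n * ∑ s, f s

lemma cubeAvg_mono {n : ℕ} {f g : (Fin n → Bool) → ℝ} (h : ∀ s, f s ≤ g s) :
    cubeAvg f ≤ cubeAvg g := by
  unfold cubeAvg
  gcongr with s
  exact h s

lemma cubeAvg_const {n : ℕ} (c : ℝ) : cubeAvg (fun _ : Fin n → Bool => c) = c := by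
  simp only [cubeAvg, Finset.sum_const, Finset.card_univ, Fintype.card_pi, Fintype.card_bool,
    Finset.prod_const, Fintype.card_fin, nsmul_eq_mul]
  rw [← mul_assoc]
  push_cast
  rw [← mul_pow]
  norm_num

lemma cubeAvg_const_mul {n : ℕ} (c : ℝ) (f : (Fin n → Bool) → ℝ) :
    cubeAvg (fun s => c * f s) = c * cubeAvg f := by
  simp only [cubeAvg, ← Finset.mul_sum]
  ring

lemma cubeAvg_add {n : ℕ} (f g : (Fin n → Bool) → ℝ) :
    cubeAvg (fun s => f s + g s) = cubeAvg f + cubeAvg g := by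
  simp only [cubeAvg, Finset.sum_add_distrib]
  ring

lemma cubeAvg_succ {n : ℕ} (f : (Fin (n + 1) → Bool) → ℝ) :
    cubeAvg f = (cubeAvg (fun s => f (Fin.cons true s)) +
      cubeAvg (fun s => f (Fin.cons false s))) / 2 := by
  have : ∑ s, f s = ∑ s, f (Fin.cons true s) + ∑ s, f (Fin.cons false s) := by
    rw [← (Fin.consEquiv (fun _ : Fin (n + 1) => Bool)).sum_comp, Fintype.sum_prod_type]
    simp [Fin.consEquiv]
  simp only [cubeAvg, this, pow_succ]
  ring

/-! ### Moments of Rademacher sums of fixed vectors -/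

section Moments

variable {F : Type*} [NormedAddCommGroup F] [NormedSpace ℝ F]

/-- The exponential moment bound for the norm of a Rademacher sum (bounded differences). -/
lemma cubeAvg_exp_norm_le {n : ℕ} (l : ℝ) (x₀ : F) (x : Fin n → F) :
    cubeAvg (fun s => Real.exp (l * ‖x₀ + ∑ j, boolSign (s j) • x j‖)) ≤
      Real.exp (l * cubeAvg (fun s => ‖x₀ + ∑ j, boolSign (s j) • x j‖)
        + l ^ 2 * (∑ j, ‖x j‖ ^ 2) / 2) := by
  induction n generalizing x₀ with
  | zero => simp [cubeAvg_const]
  | succ n ih =>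
    -- `Φ` is the conditional mean given the first sign. It is 1-Lipschitz, so the two values of
    -- that sign move it by at most `2‖x 0‖`; `cosh y ≤ exp (y² / 2)` then absorbs this one
    -- increment.
    let Φ : F → ℝ := fun y => cubeAvg (fun s => ‖y + ∑ j : Fin n, boolSign (s j) • x j.succ‖)
    have hΦ : ∀ y z, Φ y - Φ z ≤ ‖y - z‖ := fun y z => by
      have : Φ y ≤ ‖y - z‖ + Φ z := by
        calc Φ y ≤ cubeAvg (fun s => ‖y - z‖ + ‖z + ∑ j : Fin n, boolSign (s j) • x j.succ‖) := by
              refine cubeAvg_mono fun s => ?_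
              refine le_trans (le_of_eq ?_) (norm_add_le _ _)
              congr 1
              abel
          _ = ‖y - z‖ + Φ z := by rw [cubeAvg_add, cubeAvg_const]
      linarith
    have hE : ∀ (b : Bool) (s : Fin n → Bool),
        x₀ + ∑ j, boolSign ((Fin.cons b s : Fin (n + 1) → Bool) j) • x j =
          (x₀ + boolSign b • x 0) + ∑ j : Fin n, boolSign (s j) • x j.succ := fun b s => by
      rw [Fin.sum_univ_succ]
      simp [add_assoc]
    rw [cubeAvg_succ, cubeAvg_succ, Fin.sum_univ_succ]
    simp only [hE]
    set u := x₀ + boolSign true • x 0 with hu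
    set v := x₀ + boolSign false • x 0 with hv
    have h1 := ih u (fun j => x j.succ)
    have h2 := ih v (fun j => x j.succ)
    change _ ≤ Real.exp (l * ((Φ u + Φ v) / 2) + _)
    set S := ∑ j : Fin n, ‖x j.succ‖ ^ 2
    set d := (Φ u - Φ v) / 2 with hd
    have huv : ‖u - v‖ = 2 * ‖x 0‖ := by
      have : u - v = (2 : ℝ) • x 0 := by simp [hu, hv, boolSign, two_smul]
      rw [this, norm_smul]
      simp
    have hdx : |d| ≤ ‖x 0‖ := by
      have h3 := hΦ u v
      have h4 := hΦ v u
      rw [norm_sub_rev] at h4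
      rw [abs_le]
      constructor <;> linarith
    have hd2 : d ^ 2 ≤ ‖x 0‖ ^ 2 := by
      rw [← sq_abs]
      gcongr
    calc _ ≤ (Real.exp (l * Φ u + l ^ 2 * S / 2) + Real.exp (l * Φ v + l ^ 2 * S / 2)) / 2 := by
          linarith
      _ = Real.exp (l * ((Φ u + Φ v) / 2) + l ^ 2 * S / 2) * Real.cosh (l * d) := by
          rw [Real.cosh_eq, mul_div_assoc', mul_add, ← Real.exp_add, ← Real.exp_add, hd]
          congr 3 <;> ring
      _ ≤ Real.exp (l * ((Φ u + Φ v) / 2) + l ^ 2 * S / 2) * Real.exp ((l * d) ^ 2 / 2) := by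
          gcongr
          exact Real.cosh_le_exp_half_sq _
      _ ≤ _ := by
          rw [← Real.exp_add]
          apply Real.exp_le_exp.mpr
          nlinarith [mul_le_mul_of_nonneg_left hd2 (sq_nonneg l)]

/-- This is `1 + z ≤ exp z` at `z = y / q`, raised to the power `q`. It turns the exponential moment
into a `q`-th moment. -/
lemma rpow_le_mul_exp {q y : ℝ} (hq : 0 < q) (hy : 0 ≤ y) : y ^ q ≤ q ^ q * Real.exp y := by
  have h : y / q ≤ Real.exp (y / q) := by linarith [Real.add_one_le_exp (y / q)]
  have h2 : y ≤ q * Real.exp (y / q) := by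
    calc y = q * (y / q) := by field_simp
      _ ≤ _ := by gcongr
  calc y ^ q ≤ (q * Real.exp (y / q)) ^ q := by gcongr
    _ = q ^ q * Real.exp y := by
      rw [Real.mul_rpow hq.le (Real.exp_pos _).le, ← Real.exp_mul]
      congr 2
      field_simp

/-- Moments of Rademacher sums are controlled by the first moment and the square function. -/
lemma cubeAvg_norm_rpow_le {n : ℕ} {q B : ℝ} (hq : 0 < q) (hB : 0 < B) (x : Fin n → F)
    (h1 : cubeAvg (fun s => ‖∑ j, boolSign (s j) • x j‖) ≤ B) (h2 : ∑ j, ‖x j‖ ^ 2 ≤ B ^ 2) :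
    cubeAvg (fun s => ‖∑ j, boolSign (s j) • x j‖ ^ q) ≤ q ^ q * Real.exp (3 / 2) * B ^ q := by
  -- With `l = 1 / B` the mean contributes at most `1` to the exponent and the square function at
  -- most `1 / 2`, whence `exp (3 / 2)`.
  have h := cubeAvg_exp_norm_le (1 / B) 0 x
  simp only [zero_add] at h
  calc _ ≤ cubeAvg (fun s => B ^ q * q ^ q *
        Real.exp (1 / B * ‖∑ j, boolSign (s j) • x j‖)) := by
        refine cubeAvg_mono fun s => ?_
        have := rpow_le_mul_exp (y := 1 / B * ‖∑ j, boolSign (s j) • x j‖) hq (by positivity)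
        calc _ = B ^ q * (1 / B * ‖∑ j, boolSign (s j) • x j‖) ^ q := by
              rw [← Real.mul_rpow hB.le (by positivity)]
              congr 1
              field_simp
          _ ≤ _ := by
              rw [mul_assoc]
              gcongr
    _ ≤ B ^ q * q ^ q * Real.exp (3 / 2) := by
        rw [cubeAvg_const_mul]
        gcongr
        refine h.trans (Real.exp_le_exp.mpr ?_)
        have e1 : 1 / B * cubeAvg (fun s => ‖∑ j, boolSign (s j) • x j‖) ≤ 1 := by
          rw [one_div, inv_mul_le_iff₀ hB]
          linarith
        have e2 : (1 / B) ^ 2 * (∑ j, ‖x j‖ ^ 2) ≤ 1 := by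
          rw [one_div, inv_pow, inv_mul_le_iff₀ (by positivity)]
          linarith
        linarith
    _ = _ := by ring

/-- The uniform probability measure on the cube `{±1}ⁿ`. -/
noncomputable def cubeMeasure (n : ℕ) : Measure (Fin n → Bool) :=
  Measure.pi fun _ => (PMF.uniformOfFintype Bool).toMeasure

instance (n : ℕ) : IsProbabilityMeasure (cubeMeasure n) := by
  unfold cubeMeasure
  infer_instance

lemma cubeMeasure_singleton {n : ℕ} (s : Fin n → Bool) :
    cubeMeasure n {s} = ENNReal.ofReal ((1 / 2) ^ n) := by
  rw [cubeMeasure, Measure.pi_singleton]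
  have : ∀ b : Bool, (PMF.uniformOfFintype Bool).toMeasure {b} = ENNReal.ofReal (1 / 2) := by
    intro b
    rw [PMF.toMeasure_apply_singleton _ _ (measurableSet_singleton _)]
    simp [ENNReal.ofReal_inv_of_pos]
  simp only [this, Finset.prod_const, Finset.card_univ, Fintype.card_fin]
  rw [ENNReal.ofReal_pow (by norm_num)]

lemma isRademacherFamily_cube (n : ℕ) :
    IsRademacherFamily (cubeMeasure n) (fun j s => boolSign (s j)) := by
  have key : ∀ (j : Fin n) (b : Bool), cubeMeasure n {s | s j = b} = 1 / 2 := by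
    intro j b
    have hm : MeasurePreserving (fun s : Fin n → Bool => s j) (cubeMeasure n)
        ((PMF.uniformOfFintype Bool).toMeasure) := measurePreserving_eval _ j
    have : {s : Fin n → Bool | s j = b} =
        (fun s : Fin n → Bool => s j) ⁻¹' {b} := by
      ext s
      simp
    rw [this, hm.measure_preimage (measurableSet_singleton _).nullMeasurableSet,
      PMF.toMeasure_apply_singleton _ _ (measurableSet_singleton _)]
    simp
  refine ⟨fun j => ?_, fun j s => boolSign_eq _, ?_, fun j => ?_, fun j => ?_⟩
  · exact (measurable_of_finite _)
  · exact iIndepFun_pi (X := fun _ b => boolSign b) fun _ => (measurable_of_finite _).aemeasurable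
  · rw [← key j true]
    congr 1
    ext s
    cases h : s j <;> simp [boolSign, h]; norm_num
  · rw [← key j false]
    congr 1
    ext s
    cases h : s j <;> simp [boolSign, h]; norm_num

/-- The coordinate signs on the uniform cube form a Rademacher family, and there the first moment is
at most the `r`-th. -/
lemma RademacherTypeIneq.cubeAvg_le {r : ℝ} {τ : ℝ≥0} (h : RademacherTypeIneq F r τ)
    (hr : 1 ≤ r) {n : ℕ} (x : Fin n → F) :
    cubeAvg (fun s => ‖∑ j, boolSign (s j) • x j‖) ≤ τ * (∑ j, ‖x j‖ ^ r) ^ (1 / r) := by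
  have h1 := h (Fin n → Bool) (cubeMeasure n) n _ (isRademacherFamily_cube n) x
  have h2 : eLpNorm (fun s => ∑ j, boolSign (s j) • x j) 1 (cubeMeasure n) ≤
      eLpNorm (fun s => ∑ j, boolSign (s j) • x j) (ENNReal.ofReal r) (cubeMeasure n) :=
    eLpNorm_le_eLpNorm_of_exponent_le (by simpa using hr)
      (StronglyMeasurable.of_discrete).aestronglyMeasurable
  have h3 := h2.trans h1
  rw [eLpNorm_one_eq_lintegral_enorm, lintegral_fintype] at h3
  simp only [cubeMeasure_singleton, ← Finset.sum_mul] at h3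
  have e1 : ENNReal.ofReal (cubeAvg (fun s => ‖∑ j, boolSign (s j) • x j‖)) =
      (∑ s : Fin n → Bool, ‖∑ j, boolSign (s j) • x j‖ₑ) * ENNReal.ofReal ((1 / 2) ^ n) := by
    rw [cubeAvg, mul_comm, ENNReal.ofReal_mul (by positivity),
      ENNReal.ofReal_sum_of_nonneg (fun _ _ => norm_nonneg _)]
    simp only [ofReal_norm]
  have e2 : ENNReal.ofReal (τ * (∑ j, ‖x j‖ ^ r) ^ (1 / r)) =
      τ * (∑ j, ‖x j‖ₑ ^ r) ^ (1 / r) := by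
    rw [ENNReal.ofReal_mul τ.coe_nonneg, ENNReal.ofReal_coe_nnreal,
      ← ENNReal.ofReal_rpow_of_nonneg (Finset.sum_nonneg fun _ _ => by positivity)
        (by positivity), ENNReal.ofReal_sum_of_nonneg (fun _ _ => by positivity)]
    congr 3
    ext j
    rw [← ENNReal.ofReal_rpow_of_nonneg (norm_nonneg _) (by positivity), ofReal_norm]
  rw [← e1, ← e2] at h3
  exact (ENNReal.ofReal_le_ofReal_iff (by positivity)).mp h3

/-- Each entry is at most the `ℓ^r` norm `T`, so `a² = a^r a^(2-r) ≤ a^r T^(2-r)`. This is where `r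
≤ 2` matters: the type bound then also controls the square function. -/
lemma sum_sq_le_sq_rpow_sum {n : ℕ} {r : ℝ} (hr : 1 ≤ r) (hr2 : r ≤ 2) (a : Fin n → ℝ)
    (ha : ∀ j, 0 ≤ a j) : ∑ j, a j ^ 2 ≤ ((∑ j, a j ^ r) ^ (1 / r)) ^ 2 := by
  have hr0 : 0 < r := by linarith
  set S := ∑ j, a j ^ r with hS
  have hS0 : 0 ≤ S := Finset.sum_nonneg fun j _ => Real.rpow_nonneg (ha j) _
  set T := S ^ (1 / r) with hT
  have hT0 : 0 ≤ T := by positivity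
  have hTS : T ^ r = S := by
    rw [hT, ← Real.rpow_mul hS0]
    field_simp
    simp
  have hle : ∀ j, a j ≤ T := fun j => by
    rw [← Real.rpow_le_rpow_iff (ha j) hT0 hr0, hTS]
    exact Finset.single_le_sum (f := fun j => a j ^ r)
      (fun j _ => Real.rpow_nonneg (ha j) _) (Finset.mem_univ j)
  have split : ∀ y : ℝ, 0 ≤ y → y ^ 2 = y ^ r * y ^ (2 - r) := fun y hy => by
    rw [← Real.rpow_add_of_nonneg hy hr0.le (by linarith)]
    norm_num
  calc ∑ j, a j ^ 2 ≤ ∑ j, a j ^ r * T ^ (2 - r) := by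
        refine Finset.sum_le_sum fun j _ => ?_
        rw [split _ (ha j)]
        have := ha j
        gcongr
        exact hle j
    _ = T ^ 2 := by rw [← Finset.sum_mul, split T hT0, hTS]

/-- In a space of type `r ≤ q`, the `q`-th moment of a Rademacher sum of length `n`. -/
lemma RademacherTypeIneq.cubeAvg_rpow_le {r q : ℝ} {τ : ℝ≥0} (h : RademacherTypeIneq F r τ)
    (hτ : 1 ≤ τ) (hr : 1 ≤ r) (hr2 : r ≤ 2) (hrq : r ≤ q) {n : ℕ} (x : Fin n → F) :
    cubeAvg (fun s => ‖∑ j, boolSign (s j) • x j‖ ^ q) ≤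
      q ^ q * Real.exp (3 / 2) * τ ^ q * ((n : ℝ) ^ (q / r - 1) * ∑ j, ‖x j‖ ^ q) := by
  have hr0 : 0 < r := by linarith
  have hq0 : 0 < q := by linarith
  set S := ∑ j, ‖x j‖ ^ r with hS
  have hS0 : 0 ≤ S := by positivity
  have hτ' : (1 : ℝ) ≤ τ := by exact_mod_cast hτ
  have hsum : S ^ (q / r) ≤ (n : ℝ) ^ (q / r - 1) * ∑ j, ‖x j‖ ^ q := by
    have := Real.rpow_sum_le_const_mul_sum_rpow_of_nonneg Finset.univ (f := fun j => ‖x j‖ ^ r)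
      (p := q / r) (by rwa [le_div_iff₀ hr0, one_mul]) (fun j _ => by positivity)
    simp only [Finset.card_univ, Fintype.card_fin] at this
    refine this.trans_eq ?_
    congr 2
    ext j
    rw [← Real.rpow_mul (norm_nonneg _)]
    congr 1
    field_simp
  -- The moment bound needs a positive scale `B = τ S^(1/r)`, so vanishing vectors are treated
  -- apart.
  rcases hS0.eq_or_lt with h0 | h0
  · have hx : ∀ j, x j = 0 := fun j => by
      have := (Finset.sum_eq_zero_iff_of_nonneg (fun j _ => by positivity)).mp h0.symm j
        (Finset.mem_univ j)
      rwa [Real.rpow_eq_zero (norm_nonneg _) hr0.ne', norm_eq_zero] at this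
    simp only [hx, smul_zero, Finset.sum_const_zero, norm_zero, Real.zero_rpow hq0.ne',
      cubeAvg_const, mul_zero, le_refl]
  · have hB : 0 < (τ : ℝ) * S ^ (1 / r) := by positivity
    refine (cubeAvg_norm_rpow_le hq0 hB x (h.cubeAvg_le hr x) ?_).trans ?_
    · refine (sum_sq_le_sq_rpow_sum hr hr2 _ fun j => norm_nonneg _).trans ?_
      gcongr
      exact le_mul_of_one_le_left (by positivity) hτ'
    · rw [Real.mul_rpow (by positivity) (by positivity), ← Real.rpow_mul hS0,
        show 1 / r * q = q / r by ring, ← mul_assoc]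
      gcongr

end Moments

/-! ### Symmetrization of independent centered sums -/

section Symmetrization

variable {Ω F : Type*} [MeasurableSpace Ω] {P : Measure Ω} [NormedAddCommGroup F]

lemma eLpNorm_le_ofReal_iff {q c : ℝ} (hq : 0 < q) (hc : 0 ≤ c) {f : Ω → F}
    (hf : MemLp f (ENNReal.ofReal q) P) :
    eLpNorm f (ENNReal.ofReal q) P ≤ ENNReal.ofReal c ↔ ∫ ω, ‖f ω‖ ^ q ∂P ≤ c ^ q := by
  have h0 : 0 ≤ ∫ ω, ‖f ω‖ ^ q ∂P := integral_nonneg fun _ => by positivity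
  rw [hf.eLpNorm_eq_integral_rpow_norm (by simpa using hq) ENNReal.ofReal_ne_top,
    ENNReal.ofReal_le_ofReal_iff hc, ENNReal.toReal_ofReal hq.le,
    Real.rpow_inv_le_iff_of_pos h0 hc hq]

variable [NormedSpace ℝ F] [IsProbabilityMeasure P] [FiniteDimensional ℝ F] [MeasurableSpace F] [BorelSpace F]

/-- Adding an independent centered random variable does not decrease the `L^q` norm. -/
lemma eLpNorm_le_eLpNorm_add_of_indepFun {q : ℝ} (hq : 1 ≤ q) {U W : Ω → F}
    (hU : MemLp U (ENNReal.ofReal q) P) (hW : MemLp W (ENNReal.ofReal q) P)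
    (hUW : IndepFun U W P) (hW0 : ∫ ω, W ω ∂P = 0) :
    eLpNorm U (ENNReal.ofReal q) P ≤ eLpNorm (U + W) (ENNReal.ofReal q) P := by
  have : CompleteSpace F := FiniteDimensional.complete ℝ F
  have : ProperSpace F := FiniteDimensional.proper ℝ F
  have hq0 : 0 < q := by linarith
  have hmU := hU.aestronglyMeasurable.aemeasurable
  have hmW := hW.aestronglyMeasurable.aemeasurable
  have : IsProbabilityMeasure (P.map W) := Measure.isProbabilityMeasure_map hmW
  have hq1 : (1 : ℝ≥0∞) ≤ ENNReal.ofReal q := by simpa using hq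
  have hint : Integrable (fun w : F => w) (P.map W) :=
    (integrable_map_measure measurable_id.aestronglyMeasurable hmW).mpr (hW.integrable hq1)
  have hzero : ∫ w, w ∂(P.map W) = 0 := by
    rw [integral_map (f := fun w => w) hmW measurable_id.aestronglyMeasurable, hW0]
  -- Jensen's inequality: `u` is the mean of `u + W` because `W` is centered. Independence then
  -- allows integration in `u` by Tonelli.
  have point : ∀ u : F, ‖u‖ₑ ^ q ≤ ∫⁻ w, ‖u + w‖ₑ ^ q ∂(P.map W) := by
    intro u
    have h1 : ‖u‖ₑ ≤ eLpNorm (fun w => u + w) 1 (P.map W) := by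
      have : u = ∫ w, (u + w) ∂(P.map W) := by
        rw [integral_add (integrable_const _) hint, hzero]
        simp
      rw [eLpNorm_one_eq_lintegral_enorm]
      conv_lhs => rw [this]
      exact enorm_integral_le_lintegral_enorm _
    have h2 := h1.trans (eLpNorm_le_eLpNorm_of_exponent_le hq1
      ((measurable_const.add measurable_id).aestronglyMeasurable))
    rw [eLpNorm_eq_lintegral_rpow_enorm_toReal (by simpa using hq0) ENNReal.ofReal_ne_top,
      ENNReal.toReal_ofReal hq0.le, one_div] at h2
    exact (ENNReal.le_rpow_inv_iff hq0).mp h2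
  rw [eLpNorm_eq_lintegral_rpow_enorm_toReal (by simpa using hq0) ENNReal.ofReal_ne_top,
    eLpNorm_eq_lintegral_rpow_enorm_toReal (by simpa using hq0) ENNReal.ofReal_ne_top,
      ENNReal.toReal_ofReal hq0.le]
  refine ENNReal.rpow_le_rpow ?_ (by positivity)
  have hprod := (indepFun_iff_map_prod_eq_prod_map_map hmU hmW).mp hUW
  calc ∫⁻ ω, ‖U ω‖ₑ ^ q ∂P = ∫⁻ u, ‖u‖ₑ ^ q ∂(P.map U) := by
        rw [lintegral_map' (by fun_prop) hmU]
    _ ≤ ∫⁻ u, ∫⁻ w, ‖u + w‖ₑ ^ q ∂(P.map W) ∂(P.map U) := lintegral_mono point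
    _ = ∫⁻ z, ‖z.1 + z.2‖ₑ ^ q ∂((P.map U).prod (P.map W)) := by
        rw [lintegral_prod _ (by fun_prop)]
    _ = ∫⁻ ω, ‖(U + W) ω‖ₑ ^ q ∂P := by
        rw [← hprod, lintegral_map' (by fun_prop) (by fun_prop)]
        rfl

variable {n : ℕ} {η : Fin n → Ω → F}

/-- Changing signs in a sum of independent centered random variables changes its `L^q` norm by a
factor of at most `2`. -/
lemma eLpNorm_sum_le_two_mul_sign {q : ℝ} (hq : 1 ≤ q) (hind : iIndepFun η P)
    (hη : ∀ j, MemLp (η j) (ENNReal.ofReal q) P) (h0 : ∀ j, ∫ ω, η j ω ∂P = 0)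
    (s : Fin n → Bool) :
    eLpNorm (fun ω => ∑ j, η j ω) (ENNReal.ofReal q) P ≤
      2 * eLpNorm (fun ω => ∑ j, boolSign (s j) • η j ω) (ENNReal.ofReal q) P := by
  have : CompleteSpace F := FiniteDimensional.complete ℝ F
  have : ProperSpace F := FiniteDimensional.proper ℝ F
  have hq1 : (1 : ℝ≥0∞) ≤ ENNReal.ofReal q := by simpa using hq
  let U : Finset (Fin n) → Ω → F := fun S ω => ∑ j ∈ S, η j ω
  have hU : ∀ S, MemLp (U S) (ENNReal.ofReal q) P := fun S => memLp_finsetSum _ fun j _ => hη j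
  have hU0 : ∀ S, ∫ ω, U S ω ∂P = 0 := fun S => by
    rw [integral_finsetSum _ fun j _ => (hη j).integrable hq1]
    simp [h0]
  have hUneg : ∀ S, ∫ ω, (-U S) ω ∂P = 0 := fun S => by
    simp only [Pi.neg_apply, integral_neg, hU0, neg_zero]
  have hdisj : ∀ S T, Disjoint S T → IndepFun (U S) (U T) P := fun S T hST => by
    have := hind.indepFun_finset₀ S T hST fun i => (hη i).aestronglyMeasurable.aemeasurable
    have h2 := this.comp (φ := fun v : S → F => ∑ i, v i) (ψ := fun v : T → F => ∑ i, v i)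
      (by fun_prop) (by fun_prop)
    convert h2 using 1
    · ext ω
      exact (Finset.sum_coe_sort S fun j => η j ω).symm
    · ext ω
      exact (Finset.sum_coe_sort T fun j => η j ω).symm
  -- The sums over positive and negative signs are independent and centered, so each is dominated by
  -- their difference, the signed sum. The triangle inequality gives the factor 2.
  let S := Finset.univ.filter fun j => s j = true
  let T := Finset.univ.filter fun j => ¬ s j = true
  have hST : Disjoint S T := Finset.disjoint_filter_filter_not _ _ _
  have hsum : (fun ω => ∑ j, η j ω) = U S + U T := by
    ext ω
    exact (Finset.sum_filter_add_sum_filter_not _ _ _).symm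
  have hdiff : (fun ω => ∑ j, boolSign (s j) • η j ω) = U S + -U T := by
    ext ω
    rw [← Finset.sum_filter_add_sum_filter_not Finset.univ (fun j => s j = true)]
    simp only [Pi.add_apply, Pi.neg_apply, U, ← Finset.sum_neg_distrib]
    congr 1
    · exact Finset.sum_congr rfl fun j hj => by
        simp [boolSign, (Finset.mem_filter.mp hj).2]
    · exact Finset.sum_congr rfl fun j hj => by
        simp [boolSign, (Finset.mem_filter.mp hj).2]
  have hS : eLpNorm (U S) (ENNReal.ofReal q) P ≤ eLpNorm (U S + -U T) (ENNReal.ofReal q) P :=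
    eLpNorm_le_eLpNorm_add_of_indepFun hq (hU S) (hU T).neg
      ((hdisj S T hST).comp measurable_id measurable_neg) (hUneg T)
  have hT : eLpNorm (U T) (ENNReal.ofReal q) P ≤ eLpNorm (U S + -U T) (ENNReal.ofReal q) P := by
    have := eLpNorm_le_eLpNorm_add_of_indepFun hq (hU T) (hU S).neg
      ((hdisj T S hST.symm).comp measurable_id measurable_neg) (hUneg S)
    rwa [← eLpNorm_neg (f := U T + -U S), show -(U T + -U S) = U S + -U T by abel] at this
  rw [hsum, hdiff, two_mul]
  exact (eLpNorm_add_le (hU S).1 (hU T).1 hq1).trans (add_le_add hS hT)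

/-- The constant in the type inequality for sums of independent centered random variables. -/
noncomputable def sampleConst (q : ℝ) : ℝ := 2 * (q ^ q * Real.exp (3 / 2)) ^ q⁻¹

lemma sampleConst_pos {q : ℝ} (hq : 0 < q) : 0 < sampleConst q := by
  unfold sampleConst
  positivity

lemma sampleConst_rpow {q : ℝ} (hq : 0 < q) :
    sampleConst q ^ q = 2 ^ q * (q ^ q * Real.exp (3 / 2)) := by
  rw [sampleConst, Real.mul_rpow (by norm_num) (by positivity), Real.rpow_inv_rpow (by positivity)
    hq.ne']

/-- The type inequality for sums of independent centered random variables. -/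
lemma RademacherTypeIneq.eLpNorm_sum_le {r q D : ℝ} {τ : ℝ≥0} (h : RademacherTypeIneq F r τ)
    (hτ : 1 ≤ τ) (hr : 1 ≤ r) (hr2 : r ≤ 2) (hrq : r ≤ q) (hn : 1 ≤ n) (hD : 0 ≤ D)
    (hind : iIndepFun η P)
    (hη : ∀ j, MemLp (η j) (ENNReal.ofReal q) P) (h0 : ∀ j, ∫ ω, η j ω ∂P = 0)
    (hηD : ∀ j, eLpNorm (η j) (ENNReal.ofReal q) P ≤ ENNReal.ofReal D) :
    eLpNorm (fun ω => ∑ j, η j ω) (ENNReal.ofReal q) P ≤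
      ENNReal.ofReal (sampleConst q * τ * (n : ℝ) ^ (1 / r) * D) := by
  have hq : 1 ≤ q := hr.trans hrq
  have hq0 : 0 < q := by linarith
  have hr0 : 0 < r := by linarith
  have hn0 : (0 : ℝ) < n := by exact_mod_cast hn
  have hsC := sampleConst_pos hq0
  have hsum : ∀ s : Fin n → Bool, MemLp (fun ω => ∑ j, boolSign (s j) • η j ω)
      (ENNReal.ofReal q) P := fun s => memLp_finsetSum _ fun j _ => (hη j).const_smul _
  have hsum1 : MemLp (fun ω => ∑ j, η j ω) (ENNReal.ofReal q) P :=
    memLp_finsetSum _ fun j _ => hη j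
  have hintegrable : ∀ f : Ω → F, MemLp f (ENNReal.ofReal q) P →
      Integrable (fun ω => ‖f ω‖ ^ q) P := fun f hf => by
    have := hf.integrable_norm_rpow (by simpa using hq0) ENNReal.ofReal_ne_top
    rwa [ENNReal.toReal_ofReal hq0.le] at this
  rw [eLpNorm_le_ofReal_iff hq0 (by positivity) hsum1]
  have hs : ∀ s : Fin n → Bool, ∫ ω, ‖∑ j, η j ω‖ ^ q ∂P ≤
      2 ^ q * ∫ ω, ‖∑ j, boolSign (s j) • η j ω‖ ^ q ∂P := fun s => by
    have hnn : 0 ≤ ∫ ω, ‖∑ j, boolSign (s j) • η j ω‖ ^ q ∂P :=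
      integral_nonneg fun _ => by positivity
    have e := eLpNorm_sum_le_two_mul_sign hq hind hη h0 s
    rw [(hsum s).eLpNorm_eq_integral_rpow_norm (by simpa using hq0) ENNReal.ofReal_ne_top,
      ENNReal.toReal_ofReal hq0.le, ← ENNReal.ofReal_ofNat, ← ENNReal.ofReal_mul (by norm_num),
      eLpNorm_le_ofReal_iff hq0 (by positivity) hsum1, Real.mul_rpow (by norm_num) (by positivity),
      Real.rpow_inv_rpow hnn hq0.ne'] at e
    exact e
  have hηq : ∀ j, ∫ ω, ‖η j ω‖ ^ q ∂P ≤ D ^ q := fun j =>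
    (eLpNorm_le_ofReal_iff hq0 hD (hη j)).mp (hηD j)
  -- The unsigned moment does not depend on `s`, so the bound may be averaged over all signs; for
  -- each `ω` the average is a Rademacher moment with fixed vectors.
  calc ∫ ω, ‖∑ j, η j ω‖ ^ q ∂P
      = cubeAvg (fun _ : Fin n → Bool => ∫ ω, ‖∑ j, η j ω‖ ^ q ∂P) := (cubeAvg_const _).symm
    _ ≤ cubeAvg (fun s : Fin n → Bool => 2 ^ q * ∫ ω, ‖∑ j, boolSign (s j) • η j ω‖ ^ q ∂P) :=
        cubeAvg_mono hs
    _ = 2 ^ q * ∫ ω, cubeAvg (fun s => ‖∑ j, boolSign (s j) • η j ω‖ ^ q) ∂P := by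
        rw [cubeAvg_const_mul]
        simp only [cubeAvg]
        rw [integral_const_mul, integral_finsetSum _ fun s _ => hintegrable _ (hsum s)]
    _ ≤ 2 ^ q * ∫ ω, q ^ q * Real.exp (3 / 2) * τ ^ q *
          ((n : ℝ) ^ (q / r - 1) * ∑ j, ‖η j ω‖ ^ q) ∂P := by
        gcongr
        · exact (integrable_finsetSum _ fun s _ => hintegrable _ (hsum s)).const_mul _
        · exact ((integrable_finsetSum _ fun j _ => hintegrable _ (hη j)).const_mul _).const_mul _
        · intro ω
          exact h.cubeAvg_rpow_le hτ hr hr2 hrq _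
    _ = 2 ^ q * (q ^ q * Real.exp (3 / 2) * τ ^ q *
          ((n : ℝ) ^ (q / r - 1) * ∑ j, ∫ ω, ‖η j ω‖ ^ q ∂P)) := by
        rw [integral_const_mul, integral_const_mul,
          integral_finsetSum _ fun j _ => hintegrable _ (hη j)]
    _ ≤ 2 ^ q * (q ^ q * Real.exp (3 / 2) * τ ^ q *
          ((n : ℝ) ^ (q / r - 1) * ∑ j : Fin n, D ^ q)) := by
        gcongr with j
        exact hηq j
    _ = (sampleConst q * τ * (n : ℝ) ^ (1 / r) * D) ^ q := by
        rw [Real.mul_rpow (by positivity) hD, Real.mul_rpow (by positivity) (by positivity),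
          Real.mul_rpow hsC.le (by positivity), sampleConst_rpow hq0, ← Real.rpow_mul hn0.le,
          Finset.sum_const, Finset.card_univ, Fintype.card_fin, nsmul_eq_mul,
          show 1 / r * q = (q / r - 1) + 1 by ring, Real.rpow_add_one hn0.ne']
        ring

end Symmetrization

/-! ### Sample means and type constants of the subspaces -/

/-- The `L^q` error of the sample mean of random variables with values in a finite-dimensional
subspace, in terms of the type constant of that subspace. -/
lemma RademacherTypeIneq.eLpNorm_sub_sampleMean_le {Ω E : Type*} [MeasurableSpace Ω]
    {P : Measure Ω} [IsProbabilityMeasure P] [NormedAddCommGroup E] [NormedSpace ℝ E]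
    [CompleteSpace E] [MeasurableSpace E] [BorelSpace E] {V : Submodule ℝ E}
    [FiniteDimensional ℝ V] {r q D : ℝ} {τ : ℝ≥0} (h : RademacherTypeIneq V r τ)
    (hτ : 1 ≤ τ) (hr : 1 ≤ r) (hr2 : r ≤ 2) (hrq : r ≤ q) (hD : 0 ≤ D)
    {Z : Ω → E} {ζ : ℕ → Ω → E} (hZ : MemLp Z (ENNReal.ofReal q) P) (hZV : ∀ᵐ ω ∂P, Z ω ∈ V)
    (hZD : eLpNorm (fun ω => Z ω - ∫ ω', Z ω' ∂P) (ENNReal.ofReal q) P ≤ ENNReal.ofReal D)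
    (hind : iIndepFun ζ P) (hid : ∀ j, IdentDistrib (ζ j) Z P P) {M : ℕ} (hM : 1 ≤ M) :
    eLpNorm (fun ω => (∫ ω', Z ω' ∂P) - (1 / (M : ℝ)) • ∑ j ∈ Finset.range M, ζ j ω)
      (ENNReal.ofReal q) P ≤
      ENNReal.ofReal (sampleConst q * τ * D * (M : ℝ) ^ (-(1 - 1 / r))) := by
  have hq1 : (1 : ℝ≥0∞) ≤ ENNReal.ofReal q := by simpa using hr.trans hrq
  have hM0 : (0 : ℝ) < M := by exact_mod_cast hM
  have : CompleteSpace V := FiniteDimensional.complete ℝ V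
  -- A continuous projection onto `V` turns the samples, which lie in `V` only almost surely, into
  -- genuinely `V`-valued variables, while preserving independence.
  obtain ⟨π, hπ⟩ := Submodule.ClosedComplemented.of_finiteDimensional V
  have hπ' : ∀ x ∈ V, (π x : E) = x := fun x hx => congrArg Subtype.val (hπ ⟨x, hx⟩)
  set m := ∫ ω, Z ω ∂P with hm
  have hcV : (π m : E) = m := by
    have h1 : π m = ∫ ω, π (Z ω) ∂P := (π.integral_comp_comm (hZ.integrable hq1)).symm
    have h2 : (π m : E) = ∫ ω, (π (Z ω) : E) ∂P := by
      rw [h1]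
      exact (V.subtypeL.integral_comp_comm (π.integrable_comp (hZ.integrable hq1))).symm
    rw [h2]
    refine integral_congr_ae ?_
    filter_upwards [hZV] with ω hω using hπ' _ hω
  have hζV : ∀ j, ∀ᵐ ω ∂P, ζ j ω ∈ V := fun j =>
    (hid j).symm.ae_mem_snd V.closed_of_finiteDimensional.measurableSet hZV
  have hζ : ∀ j, MemLp (ζ j) (ENNReal.ofReal q) P := fun j => (hid j).memLp_iff.mpr hZ
  let η : Fin M → Ω → V := fun j ω => π (ζ j ω) - π m
  have hηind : iIndepFun η P :=
    (hind.precomp Fin.val_injective).comp (fun _ x => π x - π m)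
      fun _ => (π.continuous.sub continuous_const).measurable
  have hη : ∀ j, MemLp (η j) (ENNReal.ofReal q) P := fun j =>
    (π.comp_memLp' (hζ j)).sub (memLp_const _)
  have hη0 : ∀ j, ∫ ω, η j ω ∂P = 0 := fun j => by
    have : ∫ ω, π (ζ j ω) ∂P = π m := by
      rw [π.integral_comp_comm ((hζ j).integrable hq1), (hid j).integral_eq]
    simp only [η]
    rw [integral_sub (π.integrable_comp ((hζ j).integrable hq1)) (integrable_const _), this]
    simp
  have hcoe : ∀ j : Fin M, ∀ᵐ ω ∂P, (η j ω : E) = ζ j ω - m := fun j => by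
    filter_upwards [hζV j] with ω hω
    simp [η, hπ' _ hω, hcV]
  have hηD : ∀ j, eLpNorm (η j) (ENNReal.ofReal q) P ≤ ENNReal.ofReal D := fun j => by
    have h1 : eLpNorm (η j) (ENNReal.ofReal q) P =
        eLpNorm (fun ω => ζ j ω - m) (ENNReal.ofReal q) P := by
      refine eLpNorm_congr_norm_ae ?_
      filter_upwards [hcoe j] with ω hω
      rw [← hω, Submodule.coe_norm]
    have h2 := ((hid j).comp (u := fun x => x - m)
      (continuous_id.sub continuous_const).measurable).eLpNorm_eq (ENNReal.ofReal q)
    rw [h1]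
    exact h2.trans_le hZD
  have key := h.eLpNorm_sum_le hτ hr hr2 hrq hM hD hηind hη hη0 hηD
  have hcongr : eLpNorm (fun ω => m - (1 / (M : ℝ)) • ∑ j ∈ Finset.range M, ζ j ω)
      (ENNReal.ofReal q) P =
      eLpNorm ((1 / (M : ℝ)) • fun ω => ∑ j, η j ω) (ENNReal.ofReal q) P := by
    refine eLpNorm_congr_norm_ae ?_
    filter_upwards [ae_all_iff.mpr hcoe] with ω hω
    rw [← norm_neg, Pi.smul_apply, Submodule.coe_norm, Submodule.coe_smul,
      Submodule.coe_sum, Finset.sum_congr rfl fun j _ => hω j,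
      Fin.sum_univ_eq_sum_range (fun j => ζ j ω - m), Finset.sum_sub_distrib, smul_sub,
      Finset.sum_const, Finset.card_range, ← Nat.cast_smul_eq_nsmul ℝ, smul_smul,
      one_div, inv_mul_cancel₀ hM0.ne', one_smul, neg_sub]
  rw [hcongr, eLpNorm_const_smul]
  calc _ ≤ ENNReal.ofReal (1 / (M : ℝ)) *
        ENNReal.ofReal (sampleConst q * τ * (M : ℝ) ^ (1 / r) * D) := by
        gcongr
        rw [Real.enorm_eq_ofReal (by positivity)]
    _ = _ := by
        rw [← ENNReal.ofReal_mul (by positivity)]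
        congr 1
        rw [neg_sub, Real.rpow_sub hM0, Real.rpow_one]
        ring

/-- Test with a single nonzero vector. -/
lemma RademacherTypeIneq.one_le {F : Type*} [NormedAddCommGroup F] [NormedSpace ℝ F] [Nontrivial F]
    {r : ℝ} {τ : ℝ≥0} (hr : 1 ≤ r) (h : RademacherTypeIneq F r τ) : 1 ≤ τ := by
  obtain ⟨x, hx⟩ := exists_ne (0 : F)
  have h1 := h.cubeAvg_le hr (n := 1) (fun _ => x)
  have h2 : ∀ s : Fin 1 → Bool, ‖∑ j, boolSign (s j) • x‖ = ‖x‖ := fun s => by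
    simp [norm_smul, abs_boolSign]
  rw [funext h2, cubeAvg_const] at h1
  simp only [Finset.univ_unique, Finset.sum_const, Finset.card_singleton,
    one_smul, one_div] at h1
  rw [Real.rpow_rpow_inv (norm_nonneg _) (by linarith)] at h1
  have : (1 : ℝ) ≤ τ := le_of_mul_le_mul_right (by simpa using h1) (norm_pos_iff.mpr hx)
  exact_mod_cast this

/-- The growth condition provides admissible constants in the type `r` inequality. -/
lemma TypeConstGrowth.exists_rademacherTypeIneq {E : Type*} [NormedAddCommGroup E]
    [NormedSpace ℝ E] {V : ℕ → Submodule ℝ E} {p a₀ a₁ Cτ : ℝ}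
    (h : TypeConstGrowth V p a₀ a₁ Cτ) (hCτ : 1 ≤ Cτ) {ℓ : ℕ} (hℓ : 1 ≤ ℓ)
    (hN : 0 < Module.finrank ℝ (V ℓ)) {r : ℝ} (hpr : p ≤ r) (hr1 : 1 < r) (hr2 : r ≤ 2) :
    ∃ τ : ℝ≥0, 1 ≤ τ ∧ RademacherTypeIneq (V ℓ) r τ ∧
      (τ : ℝ) ≤ 2 * Cτ ^ (1 / r.conjExponent) *
        (Module.finrank ℝ (V ℓ) : ℝ) ^ (a₀ / r.conjExponent - a₁) := by
  have : Nontrivial (V ℓ) := Module.nontrivial_of_finrank_pos hN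
  set s := r.conjExponent with hs
  have hs0 : 0 < s := by
    rw [hs, Real.conjExponent]
    exact div_pos (by linarith) (by linarith)
  set n := Module.finrank ℝ (V ℓ) with hn
  have hn0 : (0 : ℝ) < n := by exact_mod_cast hN
  have h1 := h ℓ hℓ r ⟨⟨hpr, hr2⟩, hr1, hr2⟩
  rw [← hs, ← hn] at h1
  set T := rademacherTypeConst (V ℓ) r with hT
  have hne0 : (n : ℝ≥0∞) ≠ 0 := by exact_mod_cast hN.ne'
  have hnt : (n : ℝ≥0∞) ≠ ⊤ := ENNReal.natCast_ne_top n
  set R : ℝ := Cτ ^ (1 / s) * (n : ℝ) ^ (a₀ / s - a₁) with hR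
  have hR0 : 0 < R := by positivity
  have hRs : R ^ s = (n : ℝ) ^ (a₀ - a₁ * s) * Cτ := by
    rw [hR, Real.mul_rpow (by positivity) (by positivity), ← Real.rpow_mul (by positivity),
      ← Real.rpow_mul (by positivity), one_div_mul_cancel hs0.ne', Real.rpow_one, mul_comm]
    congr 2
    field_simp
  have hTR : T ≤ ENNReal.ofReal R := by
    rw [← ENNReal.rpow_le_rpow_iff hs0, ENNReal.ofReal_rpow_of_pos hR0, hRs,
      ENNReal.ofReal_mul (by positivity), ← ENNReal.ofReal_rpow_of_pos hn0,
      ENNReal.ofReal_natCast]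
    calc T ^ s = (n : ℝ≥0∞) ^ (a₀ - a₁ * s) * ((n : ℝ≥0∞) ^ (-(a₀ - a₁ * s)) * T ^ s) := by
          rw [← mul_assoc, ← ENNReal.rpow_add _ _ hne0 hnt, add_neg_cancel, ENNReal.rpow_zero,
            one_mul]
      _ ≤ _ := by gcongr
  -- Doubling `R` makes the inequality strict, so some admissible `τ` lies below the bound without
  -- the infimum having to be attained.
  have hlt : T < ENNReal.ofReal (2 * R) :=
    hTR.trans_lt ((ENNReal.ofReal_lt_ofReal_iff (by positivity)).mpr (by linarith))
  rw [hT, rademacherTypeConst] at hlt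
  simp only [iInf_lt_iff] at hlt
  obtain ⟨τ, ⟨-, hτ⟩, hlt⟩ := hlt
  refine ⟨τ, hτ.one_le hr1.le, hτ, ?_⟩
  rw [← ENNReal.ofReal_coe_nnreal, ENNReal.ofReal_lt_ofReal_iff (by positivity)] at hlt
  rw [mul_assoc]
  exact hlt.le

/-! ### Choice of the levels and sample numbers -/

section Numerics

lemma sum_geometric_Icc_le {ρ : ℝ} (h0 : 0 ≤ ρ) (h1 : ρ < 1) (L : ℕ) :
    ∑ ℓ ∈ Finset.Icc 1 L, ρ ^ ℓ ≤ (1 - ρ)⁻¹ := by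
  rw [← tsum_geometric_of_lt_one h0 h1]
  exact (summable_geometric_of_lt_one h0 h1).sum_le_tsum _ fun _ _ => by positivity

lemma sum_geometric_Icc_sub_le {ρ : ℝ} (h0 : 0 ≤ ρ) (h1 : ρ < 1) (L : ℕ) :
    ∑ ℓ ∈ Finset.Icc 1 L, ρ ^ (L - ℓ) ≤ (1 - ρ)⁻¹ := by
  rw [← tsum_geometric_of_lt_one h0 h1]
  have hinj : Set.InjOn (fun ℓ => L - ℓ) (Finset.Icc 1 L : Set ℕ) := by
    intro a ha b hb hab
    simp only [Finset.coe_Icc, Set.mem_Icc] at ha hb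
    simp only at hab
    omega
  rw [← Finset.sum_image (f := fun k => ρ ^ k) hinj]
  exact (summable_geometric_of_lt_one h0 h1).sum_le_tsum _ fun _ _ => by positivity

lemma pow_rpow_comm {A : ℝ} (hA : 0 ≤ A) (n : ℕ) (x : ℝ) : (A ^ n) ^ x = (A ^ x) ^ n := by
  rw [← Real.rpow_natCast, ← Real.rpow_natCast, ← Real.rpow_mul hA, ← Real.rpow_mul hA, mul_comm]

lemma sum_pow_rpow_le {A e : ℝ} (hA : 1 < A) (he : 0 < e) (L : ℕ) :
    ∑ ℓ ∈ Finset.Icc 1 L, (A ^ ℓ) ^ e ≤ (1 - A ^ (-e))⁻¹ * (A ^ L) ^ e := by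
  have hA0 : 0 < A := by linarith
  have hρ : A ^ (-e) < 1 := Real.rpow_lt_one_of_one_lt_of_neg hA (by linarith)
  calc ∑ ℓ ∈ Finset.Icc 1 L, (A ^ ℓ) ^ e
      = ∑ ℓ ∈ Finset.Icc 1 L, (A ^ (-e)) ^ (L - ℓ) * (A ^ L) ^ e := by
        refine Finset.sum_congr rfl fun ℓ hℓ => ?_
        have hℓL := (Finset.mem_Icc.mp hℓ).2
        rw [pow_rpow_comm hA0.le, pow_rpow_comm hA0.le, Real.rpow_neg hA0.le, inv_pow,
          pow_sub₀ _ (by positivity) hℓL, mul_inv, inv_inv]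
        field_simp
    _ ≤ _ := by
        rw [← Finset.sum_mul]
        gcongr
        exact sum_geometric_Icc_sub_le (by positivity) hρ L

/-- Choice of the finest level `L`. -/
lemma exists_finest_level {α A H : ℝ} (hα : 0 < α) (hA : 1 < A) (hH : 0 < H) :
    ∃ K : ℝ, 1 ≤ K ∧ ∀ ε ∈ Set.Ioc (0 : ℝ) (1 / 2), ∃ L : ℕ, 1 ≤ L ∧
      H * (A ^ L) ^ (-α) ≤ ε / 4 ∧ A ^ L ≤ K * ε ^ (-(1 / α)) ∧ (L : ℝ) ≤ K * |Real.logb A ε| := by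
  have hA0 : 0 < A := by linarith
  set Q := (4 * H) ^ (1 / α) with hQ
  have hQ0 : 0 < Q := by positivity
  set K₁ := A * (1 + Q) with hK₁
  have hK₁1 : 1 ≤ K₁ := by nlinarith
  have hl2 : 0 < Real.logb A 2 := Real.logb_pos hA (by norm_num)
  have hlK : 0 ≤ Real.logb A K₁ := Real.logb_nonneg hA hK₁1
  refine ⟨max K₁ (Real.logb A K₁ / Real.logb A 2 + 1 / α), le_max_of_le_left hK₁1, ?_⟩
  rintro ε ⟨hε0, hε2⟩
  have hε1 : 1 ≤ ε ^ (-(1 / α)) :=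
    Real.one_le_rpow_of_pos_of_le_one_of_nonpos hε0 (by linarith)
      (by rw [neg_nonpos]; positivity)
  -- The summand `1` in `1 + Q` keeps the target at least `1`, as needed to place it between
  -- consecutive powers of `A`; `L = n + 1` is then positive.
  obtain ⟨n, hn1, hn2⟩ := exists_nat_pow_near (x := (1 + Q) * ε ^ (-(1 / α))) (y := A)
    (by nlinarith) hA
  have hAL : A ^ (n + 1) ≤ K₁ * ε ^ (-(1 / α)) := by
    rw [pow_succ, hK₁]
    calc A ^ n * A ≤ ((1 + Q) * ε ^ (-(1 / α))) * A := by gcongr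
      _ = _ := by ring
  refine ⟨n + 1, by omega, ?_, ?_, ?_⟩
  · have h1 : Q * ε ^ (-(1 / α)) ≤ A ^ (n + 1) := by
      refine le_trans ?_ hn2.le
      gcongr
      linarith
    have h2 : (A ^ (n + 1)) ^ (-α) ≤ (Q * ε ^ (-(1 / α))) ^ (-α) :=
      Real.rpow_le_rpow_of_nonpos (by positivity) h1 (by linarith)
    have h3 : (Q * ε ^ (-(1 / α))) ^ (-α) = (4 * H)⁻¹ * ε := by
      rw [Real.mul_rpow hQ0.le (by positivity), ← Real.rpow_mul hε0.le, hQ,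
        ← Real.rpow_mul (by positivity), show 1 / α * -α = -1 by field_simp,
        show -(1 / α) * -α = 1 by field_simp, Real.rpow_one, Real.rpow_neg_one]
    calc H * (A ^ (n + 1)) ^ (-α) ≤ H * ((4 * H)⁻¹ * ε) := by
          rw [← h3]
          gcongr
      _ = ε / 4 := by field_simp
  · refine hAL.trans ?_
    gcongr
    exact le_max_left _ _
  · have hlog : Real.logb A ε ≤ -Real.logb A 2 := by
      rw [← Real.logb_inv]
      exact Real.logb_le_logb_of_le hA hε0 (by simpa using hε2)
    have habs : |Real.logb A ε| = -Real.logb A ε := abs_of_nonpos (by linarith)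
    have h1 := Real.logb_le_logb_of_le hA (by positivity) hAL
    rw [Real.logb_pow, Real.logb_self_eq_one hA, Real.logb_mul (by positivity) (by positivity),
      Real.logb_rpow_eq_mul_logb_of_pos hε0, mul_one] at h1
    set Λ := |Real.logb A ε|
    -- As `ε ≤ 1 / 2`, `|log_A ε|` is bounded below and absorbs the additive constant.
    have hΛ : Real.logb A 2 ≤ Λ := by linarith
    calc ((n + 1 : ℕ) : ℝ) ≤ Real.logb A K₁ + 1 / α * Λ := by
          rw [habs]
          linarith
      _ ≤ Real.logb A K₁ / Real.logb A 2 * Λ + 1 / α * Λ := by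
          gcongr
          rw [div_mul_eq_mul_div, le_div_iff₀ hl2]
          gcongr
      _ = (Real.logb A K₁ / Real.logb A 2 + 1 / α) * Λ := by ring
      _ ≤ _ := by
          gcongr
          exact le_max_right _ _

/-- `L` and `M` meet the accuracy `ε` in the multilevel error bound with exponent `s`, at total
cost at most `B`. -/
def IsAccurateChoice (α γ a₀ b A H₁ H₂ G s ε B : ℝ) (L : ℕ) (M : ℕ → ℕ) : Prop :=
  1 ≤ L ∧ (∀ ℓ, 1 ≤ M ℓ) ∧
    H₁ * (A ^ L) ^ (-α) +
      ∑ ℓ ∈ Finset.Icc 1 L, H₂ * (A ^ ℓ) ^ (a₀ / s - b) * (M ℓ : ℝ) ^ (-(1 / s)) < ε ∧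
    ∑ ℓ ∈ Finset.Icc 1 L, (M ℓ : ℝ) * (G * (A ^ ℓ) ^ γ) ≤ B

variable {α γ a₀ b A H₁ H₂ G s : ℝ}

lemma IsAccurateChoice.mono {ε B B' : ℝ} {L : ℕ} {M : ℕ → ℕ}
    (h : IsAccurateChoice α γ a₀ b A H₁ H₂ G s ε B L M) (hB : B ≤ B') :
    IsAccurateChoice α γ a₀ b A H₁ H₂ G s ε B' L M :=
  ⟨h.1, h.2.1, h.2.2.1, h.2.2.2.trans hB⟩

/-- Choice of the numbers of samples which distributes the error over the levels according to
the weights `w L ℓ`. -/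
lemma exists_isAccurateChoice_of_weights (hα : 0 < α) (hγ : 0 < γ) (hA : 1 < A) (hH₁ : 0 < H₁)
    (hH₂ : 0 < H₂) (hG : 0 < G) (hs : 0 < s) :
    ∃ K : ℝ, 1 ≤ K ∧ ∀ w : ℕ → ℕ → ℝ, (∀ L ℓ, 1 ≤ L → 0 < w L ℓ) →
      (∀ L, ∑ ℓ ∈ Finset.Icc 1 L, w L ℓ ≤ 1) →
      ∀ ε ∈ Set.Ioc (0 : ℝ) (1 / 2), ∃ (L : ℕ) (M : ℕ → ℕ),
        IsAccurateChoice α γ a₀ b A H₁ H₂ G s ε (K * (ε ^ (-(γ / α)) + ε ^ (-s) *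
          ∑ ℓ ∈ Finset.Icc 1 L, (A ^ ℓ) ^ (γ + a₀ - b * s) * (w L ℓ) ^ (-s))) L M ∧
        A ^ L ≤ K * ε ^ (-(1 / α)) ∧ (L : ℝ) ≤ K * |Real.logb A ε| := by
  have hA0 : 0 < A := by linarith
  obtain ⟨K₀, hK₀, hL⟩ := exists_finest_level hα hA hH₁
  have hρ : 0 < 1 - A ^ (-γ) := by
    linarith [Real.rpow_lt_one_of_one_lt_of_neg hA (neg_lt_zero.mpr hγ)]
  set K₁ := G * ((1 - A ^ (-γ))⁻¹ * K₀ ^ γ) with hK₁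
  set K₂ := G * (2 * H₂) ^ s with hK₂
  have hK₁0 : 0 < K₁ := by positivity
  have hK₂0 : 0 < K₂ := by positivity
  refine ⟨K₀ + K₁ + K₂, by linarith, fun w hw hw1 ε hε => ?_⟩
  obtain ⟨L, hL1, hbias, hAL, hLlog⟩ := hL ε hε
  obtain ⟨hε0, hε2⟩ := hε
  -- Chosen so that `u ℓ ^ s` samples leave exactly the error `ε / 2 * w L ℓ` on level `ℓ`. With
  -- bias at most `ε / 4`, the total stays strictly below `ε`.
  let u : ℕ → ℝ := fun ℓ => 2 * H₂ * (A ^ ℓ) ^ (a₀ / s - b) / (ε * w L ℓ)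
  have hw0 : ∀ ℓ, 0 < w L ℓ := fun ℓ => hw L ℓ hL1
  have hu : ∀ ℓ, 0 < u ℓ := fun ℓ => by
    have := hw0 ℓ
    positivity
  refine ⟨L, fun ℓ => ⌈u ℓ ^ s⌉₊, ⟨hL1, ?_, ?_, ?_⟩, ?_, ?_⟩
  · intro ℓ
    have := hu ℓ
    exact Nat.one_le_iff_ne_zero.mpr (Nat.ceil_pos.mpr (by positivity)).ne'
  · have hterm : ∀ ℓ, H₂ * (A ^ ℓ) ^ (a₀ / s - b) * ((⌈u ℓ ^ s⌉₊ : ℕ) : ℝ) ^ (-(1 / s)) ≤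
        ε / 2 * w L ℓ := fun ℓ => by
      have hu0 := hu ℓ
      have hwℓ := hw0 ℓ
      have h1 : ((⌈u ℓ ^ s⌉₊ : ℕ) : ℝ) ^ (-(1 / s)) ≤ (u ℓ ^ s) ^ (-(1 / s)) :=
        Real.rpow_le_rpow_of_nonpos (by positivity) (Nat.le_ceil _)
          (by rw [neg_nonpos]; positivity)
      have h2 : (u ℓ ^ s) ^ (-(1 / s)) = (u ℓ)⁻¹ := by
        rw [← Real.rpow_mul hu0.le, show s * -(1 / s) = -1 by field_simp, Real.rpow_neg_one]
      rw [h2] at h1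
      calc _ ≤ H₂ * (A ^ ℓ) ^ (a₀ / s - b) * (u ℓ)⁻¹ := by gcongr
        _ = _ := by
          have : (A ^ ℓ) ^ (a₀ / s - b) ≠ 0 := by positivity
          simp only [u]
          field_simp
    have hsum := Finset.sum_le_sum fun ℓ (_ : ℓ ∈ Finset.Icc 1 L) => hterm ℓ
    rw [← Finset.mul_sum] at hsum
    have := mul_le_mul_of_nonneg_left (hw1 L) (by positivity : 0 ≤ ε / 2)
    linarith
  · have hterm : ∀ ℓ, ((⌈u ℓ ^ s⌉₊ : ℕ) : ℝ) * (G * (A ^ ℓ) ^ γ) ≤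
        G * (A ^ ℓ) ^ γ + K₂ * (ε ^ (-s) * ((A ^ ℓ) ^ (γ + a₀ - b * s) * (w L ℓ) ^ (-s))) :=
      fun ℓ => by
      have hu0 := hu ℓ
      have hwℓ := hw0 ℓ
      have hus : u ℓ ^ s = (2 * H₂) ^ s * (A ^ ℓ) ^ (a₀ - b * s) * (ε ^ (-s) * (w L ℓ) ^ (-s)) := by
        simp only [u]
        rw [Real.div_rpow (by positivity) (by positivity), Real.mul_rpow (by positivity)
          (by positivity), Real.mul_rpow hε0.le hwℓ.le, ← Real.rpow_mul (by positivity),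
          Real.rpow_neg hε0.le, Real.rpow_neg hwℓ.le, ← mul_inv, div_eq_mul_inv,
          show (a₀ / s - b) * s = a₀ - b * s by field_simp]
      calc _ ≤ (u ℓ ^ s + 1) * (G * (A ^ ℓ) ^ γ) := by
            gcongr
            exact (Nat.ceil_lt_add_one (by positivity)).le
        _ = _ := by
            rw [hus, show γ + a₀ - b * s = γ + (a₀ - b * s) by ring,
              Real.rpow_add (by positivity : 0 < A ^ ℓ), hK₂]
            ring
    have hsum := Finset.sum_le_sum fun ℓ (_ : ℓ ∈ Finset.Icc 1 L) => hterm ℓ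
    rw [Finset.sum_add_distrib, ← Finset.mul_sum, ← Finset.mul_sum, ← Finset.mul_sum] at hsum
    -- Rounding up adds at most one sample per level; the finest level dominates this extra cost.
    have hgeo : G * ∑ ℓ ∈ Finset.Icc 1 L, (A ^ ℓ) ^ γ ≤ K₁ * ε ^ (-(γ / α)) := by
      have h1 : (A ^ L) ^ γ ≤ K₀ ^ γ * ε ^ (-(γ / α)) := by
        calc (A ^ L) ^ γ ≤ (K₀ * ε ^ (-(1 / α))) ^ γ := by gcongr
          _ = _ := by
            rw [Real.mul_rpow (by linarith) (by positivity), ← Real.rpow_mul hε0.le]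
            congr 2
            ring
      calc _ ≤ G * ((1 - A ^ (-γ))⁻¹ * (K₀ ^ γ * ε ^ (-(γ / α)))) := by
            gcongr
            refine (sum_pow_rpow_le hA hγ L).trans ?_
            gcongr
        _ = _ := by rw [hK₁]; ring
    refine hsum.trans ?_
    set S := ε ^ (-s) * ∑ ℓ ∈ Finset.Icc 1 L, (A ^ ℓ) ^ (γ + a₀ - b * s) * (w L ℓ) ^ (-s) with hS
    have hS0 : 0 ≤ S := by
      refine mul_nonneg (by positivity) (Finset.sum_nonneg fun ℓ _ => ?_)
      have := hw0 ℓ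
      positivity
    have hE0 : 0 < ε ^ (-(γ / α)) := by positivity
    nlinarith [mul_nonneg hK₁0.le hS0, mul_pos hK₂0 hE0, mul_pos (by linarith : 0 < K₀) hE0,
      mul_nonneg (by linarith : 0 ≤ K₀) hS0]
  · refine hAL.trans ?_
    gcongr
    linarith
  · refine hLlog.trans ?_
    gcongr
    linarith

/-- The cost is dominated by the coarse levels. -/
lemma exists_isAccurateChoice_of_lt (hα : 0 < α) (hγ : 0 < γ) (hA : 1 < A) (hH₁ : 0 < H₁)
    (hH₂ : 0 < H₂) (hG : 0 < G) (hs : 0 < s) (h : γ + a₀ < b * s) :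
    ∃ K : ℝ, 0 < K ∧ ∀ ε ∈ Set.Ioc (0 : ℝ) (1 / 2), ∃ (L : ℕ) (M : ℕ → ℕ),
      IsAccurateChoice α γ a₀ b A H₁ H₂ G s ε (K * (ε ^ (-(γ / α)) + ε ^ (-s))) L M := by
  have hA0 : 0 < A := by linarith
  obtain ⟨K, hK, hc⟩ := exists_isAccurateChoice_of_weights (a₀ := a₀) (b := b) hα hγ hA hH₁ hH₂
    hG hs
  -- The weights `ρ ^ ℓ` spend half of the available decay: `ρ ^ (-s)` takes back its square root,
  -- and the cost terms still decay like `θ ^ ℓ`.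
  set κ := (b * s - (γ + a₀)) / (2 * s) with hκ
  have hκ0 : 0 < κ := div_pos (by linarith) (by positivity)
  set ρ := A ^ (-κ) with hρ
  have hρ0 : 0 < ρ := by positivity
  have hρ1 : ρ < 1 := Real.rpow_lt_one_of_one_lt_of_neg hA (by linarith)
  have h1ρ : 0 < 1 - ρ := by linarith
  set θ := A ^ (-((b * s - (γ + a₀)) / 2)) with hθ
  have hθ0 : 0 < θ := by positivity
  have hθ1 : θ < 1 := Real.rpow_lt_one_of_one_lt_of_neg hA (by linarith)
  set K' := (1 - ρ) ^ (-s) * (1 - θ)⁻¹ with hK'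
  have hK'0 : 0 < K' := mul_pos (by positivity) (inv_pos.mpr (by linarith))
  refine ⟨K * (1 + K'), by positivity, fun ε hε => ?_⟩
  obtain ⟨L, M, hLM, -, -⟩ := hc (fun _ ℓ => (1 - ρ) * ρ ^ ℓ) (fun L ℓ _ => by positivity)
    (fun L => by
      rw [← Finset.mul_sum, ← le_div_iff₀' h1ρ, one_div]
      exact sum_geometric_Icc_le hρ0.le hρ1 L) ε hε
  refine ⟨L, M, hLM.mono ?_⟩
  have hε0 := hε.1
  have hsum : ∑ ℓ ∈ Finset.Icc 1 L, (A ^ ℓ) ^ (γ + a₀ - b * s) * ((1 - ρ) * ρ ^ ℓ) ^ (-s) ≤ K' := by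
    calc _ = ∑ ℓ ∈ Finset.Icc 1 L, (1 - ρ) ^ (-s) * θ ^ ℓ := by
          refine Finset.sum_congr rfl fun ℓ _ => ?_
          rw [Real.mul_rpow h1ρ.le (by positivity), pow_rpow_comm hA0.le, pow_rpow_comm hρ0.le,
            mul_left_comm, ← mul_pow, hρ, ← Real.rpow_mul hA0.le, ← Real.rpow_add hA0, hθ]
          congr 3
          rw [hκ]
          field_simp
          ring
      _ ≤ K' := by
          rw [← Finset.mul_sum, hK']
          gcongr
          exact sum_geometric_Icc_le hθ0.le hθ1 L
  rw [mul_assoc]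
  have h1 : 0 < ε ^ (-(γ / α)) := by positivity
  have h2 : 0 < ε ^ (-s) := by positivity
  gcongr
  nlinarith [mul_le_mul_of_nonneg_left hsum h2.le, mul_pos hK'0 h1]

/-- All levels contribute equally to the cost. -/
lemma exists_isAccurateChoice_of_eq (hα : 0 < α) (hγ : 0 < γ) (hA : 1 < A) (hH₁ : 0 < H₁)
    (hH₂ : 0 < H₂) (hG : 0 < G) (hs : 0 < s) (h : γ + a₀ = b * s) :
    ∃ K : ℝ, 0 < K ∧ ∀ ε ∈ Set.Ioc (0 : ℝ) (1 / 2), ∃ (L : ℕ) (M : ℕ → ℕ),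
      IsAccurateChoice α γ a₀ b A H₁ H₂ G s ε
        (K * (ε ^ (-(γ / α)) + ε ^ (-s) * |Real.logb A ε| ^ (s + 1))) L M := by
  obtain ⟨K, hK, hc⟩ := exists_isAccurateChoice_of_weights (a₀ := a₀) (b := b) hα hγ hA hH₁ hH₂
    hG hs
  have hK0 : 0 < K := by linarith
  set K' := K ^ (s + 1) with hK'
  have hK'0 : 0 < K' := by positivity
  refine ⟨K * (1 + K'), by positivity, fun ε hε => ?_⟩
  -- Uniform weights make each of the `L` summands `L ^ s`, hence the power `s + 1` of the
  -- logarithm.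
  obtain ⟨L, M, hLM, -, hL⟩ := hc (fun L _ => (L : ℝ)⁻¹)
    (fun L _ hL => by
      have : (0 : ℝ) < L := by exact_mod_cast hL
      positivity)
    (fun L => by
      rw [Finset.sum_const, Nat.card_Icc, Nat.add_sub_cancel, nsmul_eq_mul]
      exact mul_inv_le_one) ε hε
  refine ⟨L, M, hLM.mono ?_⟩
  have hε0 := hε.1
  have hL0 : (0 : ℝ) < L := by exact_mod_cast hLM.1
  have hsum : ∑ ℓ ∈ Finset.Icc 1 L, (A ^ ℓ) ^ (γ + a₀ - b * s) * ((L : ℝ)⁻¹) ^ (-s) ≤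
      K' * |Real.logb A ε| ^ (s + 1) := by
    calc _ = (L : ℝ) ^ (s + 1) := by
          rw [h, sub_self]
          simp only [Real.rpow_zero, one_mul]
          rw [Finset.sum_const, Nat.card_Icc, Nat.add_sub_cancel, nsmul_eq_mul,
            Real.inv_rpow hL0.le, Real.rpow_neg hL0.le, inv_inv, Real.rpow_add_one hL0.ne',
            mul_comm]
      _ ≤ (K * |Real.logb A ε|) ^ (s + 1) := by gcongr
      _ = _ := by rw [Real.mul_rpow hK0.le (abs_nonneg _)]
  rw [mul_assoc]
  have h1 : 0 < ε ^ (-(γ / α)) := by positivity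
  have h2 : 0 < ε ^ (-s) := by positivity
  have h3 : 0 ≤ |Real.logb A ε| ^ (s + 1) := by positivity
  gcongr
  nlinarith [mul_le_mul_of_nonneg_left hsum h2.le, mul_pos hK'0 h1, mul_nonneg h2.le h3]

/-- The cost is dominated by the fine levels. -/
lemma exists_isAccurateChoice_of_gt (hα : 0 < α) (hγ : 0 < γ) (hA : 1 < A) (hH₁ : 0 < H₁)
    (hH₂ : 0 < H₂) (hG : 0 < G) (hs : 0 < s) (h : b * s < γ + a₀) :
    ∃ K : ℝ, 0 < K ∧ ∀ ε ∈ Set.Ioc (0 : ℝ) (1 / 2), ∃ (L : ℕ) (M : ℕ → ℕ),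
      IsAccurateChoice α γ a₀ b A H₁ H₂ G s ε
        (K * (ε ^ (-(γ / α)) + ε ^ (-s - (γ + a₀ - b * s) / α))) L M := by
  have hA0 : 0 < A := by linarith
  obtain ⟨K, hK, hc⟩ := exists_isAccurateChoice_of_weights (a₀ := a₀) (b := b) hα hγ hA hH₁ hH₂
    hG hs
  have hK0 : 0 < K := by linarith
  set δ := γ + a₀ - b * s with hδ
  have hδ0 : 0 < δ := by linarith
  -- Again half of the decay is spent, now counted downwards from level `L`.
  set ρ := A ^ (-(δ / (2 * s))) with hρ
  have hρ0 : 0 < ρ := by positivity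
  have hρ1 : ρ < 1 := Real.rpow_lt_one_of_one_lt_of_neg hA (by rw [neg_lt_zero]; positivity)
  have h1ρ : 0 < 1 - ρ := by linarith
  set θ := A ^ (-(δ / 2)) with hθ
  have hθ0 : 0 < θ := by positivity
  have hθ1 : θ < 1 := Real.rpow_lt_one_of_one_lt_of_neg hA (by linarith)
  have h1θ : 0 < 1 - θ := by linarith
  set K' := (1 - ρ) ^ (-s) * (1 - θ)⁻¹ * K ^ δ with hK'
  have hK'0 : 0 < K' := by positivity
  refine ⟨K * (1 + K'), by positivity, fun ε hε => ?_⟩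
  obtain ⟨L, M, hLM, hL, -⟩ := hc (fun L ℓ => (1 - ρ) * ρ ^ (L - ℓ)) (fun L ℓ _ => by positivity)
    (fun L => by
      rw [← Finset.mul_sum, ← le_div_iff₀' h1ρ, one_div]
      exact sum_geometric_Icc_sub_le hρ0.le hρ1 L) ε hε
  refine ⟨L, M, hLM.mono ?_⟩
  have hε0 := hε.1
  have hsum : ∑ ℓ ∈ Finset.Icc 1 L, (A ^ ℓ) ^ δ * ((1 - ρ) * ρ ^ (L - ℓ)) ^ (-s) ≤
      K' * ε ^ (-(δ / α)) := by
    calc _ = ∑ ℓ ∈ Finset.Icc 1 L, (1 - ρ) ^ (-s) * (A ^ L) ^ δ * θ ^ (L - ℓ) := by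
          refine Finset.sum_congr rfl fun ℓ hℓ => ?_
          have hℓL := (Finset.mem_Icc.mp hℓ).2
          have hAℓ : A ^ L = A ^ ℓ * A ^ (L - ℓ) := by rw [← pow_add, Nat.add_sub_cancel' hℓL]
          rw [Real.mul_rpow h1ρ.le (by positivity), hAℓ, Real.mul_rpow (by positivity)
            (by positivity), pow_rpow_comm hρ0.le, pow_rpow_comm hA0.le (L - ℓ), mul_left_comm,
            mul_assoc, mul_assoc, ← mul_pow, hρ, hθ, ← Real.rpow_mul hA0.le, ← Real.rpow_add hA0]
          congr 4
          field_simp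
          ring
      _ ≤ (1 - ρ) ^ (-s) * (A ^ L) ^ δ * (1 - θ)⁻¹ := by
          rw [← Finset.mul_sum]
          gcongr
          exact sum_geometric_Icc_sub_le hθ0.le hθ1 L
      _ ≤ (1 - ρ) ^ (-s) * (K * ε ^ (-(1 / α))) ^ δ * (1 - θ)⁻¹ := by gcongr
      _ = _ := by
          rw [Real.mul_rpow hK0.le (by positivity), ← Real.rpow_mul hε0.le,
            show -(1 / α) * δ = -(δ / α) by ring, hK']
          ring
  rw [mul_assoc, sub_eq_add_neg (-s), Real.rpow_add hε0]
  have h1 : 0 < ε ^ (-(γ / α)) := by positivity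
  have h2 : 0 < ε ^ (-s) := by positivity
  have h3 : 0 < ε ^ (-(δ / α)) := by positivity
  gcongr
  nlinarith [mul_le_mul_of_nonneg_left hsum h2.le, mul_pos hK'0 h1, mul_pos h2 h3]

lemma conjExponent_le_conjExponent {x y : ℝ} (hx : 1 < x) (hxy : x ≤ y) :
    y.conjExponent ≤ x.conjExponent := by
  unfold Real.conjExponent
  rw [div_le_div_iff₀ (by linarith) (by linarith)]
  linarith

lemma one_lt_conjExponent {x : ℝ} (hx : 1 < x) : 1 < x.conjExponent := by
  unfold Real.conjExponent
  rw [lt_div_iff₀ (by linarith)]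
  linarith

lemma conjExponent_conjExponent {x : ℝ} (hx : 1 < x) : x.conjExponent.conjExponent = x := by
  unfold Real.conjExponent
  have : x - 1 ≠ 0 := by linarith
  field_simp
  ring

/-- The parameters of the multilevel estimator can be chosen with cost of order `mlmcRate`. -/
lemma exists_isAccurateChoice_mlmcRate {p q a₁ β : ℝ} {H : ℝ → ℝ} (hp : p ∈ Set.Icc (1 : ℝ) 2)
    (hq : 1 < q) (hpq : p ≤ q) (hα : 0 < α) (hβ : 0 < β) (hγ : 0 < γ) (ha₁ : 0 ≤ a₁)
    (hA : 1 < A) (hH₁ : 0 < H₁) (hH : ∀ s, 0 < H s) (hG : 0 < G) :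
    ∃ r : ℝ, p ≤ r ∧ 1 < r ∧ r ≤ 2 ∧ r ≤ q ∧ ∃ K : ℝ, 0 < K ∧
      ∀ ε ∈ Set.Ioc (0 : ℝ) (1 / 2), ∃ (L : ℕ) (M : ℕ → ℕ),
        IsAccurateChoice α γ a₀ (β + a₁) A H₁ (H r.conjExponent) G r.conjExponent ε
          (K * mlmcRate p q α β γ a₀ a₁ A ε) L M := by
  have hb : 0 < β + a₁ := by linarith
  set qb := min q 2 with hqb
  have hqb1 : 1 < qb := lt_min hq (by norm_num)
  have hqb2 : qb ≤ 2 := min_le_right _ _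
  have hqbq : qb ≤ q := min_le_left _ _
  have hpqb : p ≤ qb := le_min hpq hp.2
  have hq' : 1 < qb.conjExponent := one_lt_conjExponent hqb1
  unfold mlmcRate
  simp only [← hqb]
  set t := (γ + a₀) / (β + a₁) with ht
  have htb : (β + a₁) * t = γ + a₀ := mul_div_cancel₀ _ hb.ne'
  by_cases h1 : t < qb.conjExponent
  · refine ⟨qb, hpqb, hqb1, hqb2, hqbq, ?_⟩
    simp only [if_pos h1]
    refine exists_isAccurateChoice_of_lt hα hγ hA hH₁ (hH _) hG (by linarith) ?_
    rw [← htb]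
    gcongr
  simp only [if_neg h1]
  by_cases h2 : t = qb.conjExponent
  · refine ⟨qb, hpqb, hqb1, hqb2, hqbq, ?_⟩
    simp only [if_pos h2]
    refine exists_isAccurateChoice_of_eq hα hγ hA hH₁ (hH _) hG (by linarith) ?_
    rw [← htb, h2]
  simp only [if_neg h2]
  have h3 : qb.conjExponent < t := lt_of_le_of_ne (not_lt.mp h1) (Ne.symm h2)
  have hfine : ∀ r : ℝ, 1 < r → r.conjExponent < t → ∃ K : ℝ, 0 < K ∧
      ∀ ε ∈ Set.Ioc (0 : ℝ) (1 / 2), ∃ (L : ℕ) (M : ℕ → ℕ),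
        IsAccurateChoice α γ a₀ (β + a₁) A H₁ (H r.conjExponent) G r.conjExponent ε
          (K * (ε ^ (-(γ / α)) + ε ^ (-r.conjExponent -
            (γ + a₀ - (β + a₁) * r.conjExponent) / α))) L M := by
    intro r hr hrt
    have := one_lt_conjExponent hr
    refine exists_isAccurateChoice_of_gt hα hγ hA hH₁ (hH _) hG (by linarith) ?_
    rw [← htb]
    gcongr
  by_cases h4 : p = 1 ∨ t ≤ p.conjExponent
  · simp only [if_pos h4]
    -- The exponent `s + (γ + a₀ - (β + a₁) s) / α` has slope `1 - (β + a₁) / α` in `s`. If this is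
    -- nonnegative, the smallest `s`, namely `q̄'`, is best; otherwise `s` is raised until it meets
    -- `t` or `p'`.
    by_cases h5 : β + a₁ ≤ α
    · simp only [if_pos h5]
      exact ⟨qb, hpqb, hqb1, hqb2, hqbq, hfine qb hqb1 h3⟩
    · simp only [if_neg h5]
      have ht1 : 1 < t := hq'.trans h3
      have htq : t.conjExponent ≤ qb := by
        rw [← conjExponent_conjExponent hqb1]
        exact conjExponent_le_conjExponent hq' h3.le
      refine ⟨t.conjExponent, ?_, one_lt_conjExponent ht1, htq.trans hqb2, htq.trans hqbq, ?_⟩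
      · rcases eq_or_ne p 1 with h6 | h6
        · rw [h6]
          exact (one_lt_conjExponent ht1).le
        · have hp1 : 1 < p := lt_of_le_of_ne hp.1 (Ne.symm h6)
          rw [← conjExponent_conjExponent hp1]
          exact conjExponent_le_conjExponent ht1 (h4.resolve_left h6)
      · rw [conjExponent_conjExponent ht1]
        exact exists_isAccurateChoice_of_eq hα hγ hA hH₁ (hH _) hG (by linarith) htb.symm
  · simp only [if_neg h4]
    by_cases h5 : β + a₁ ≤ α
    · simp only [if_pos h5]
      exact ⟨qb, hpqb, hqb1, hqb2, hqbq, hfine qb hqb1 h3⟩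
    · simp only [if_neg h5]
      push Not at h4
      have hp1 : 1 < p := lt_of_le_of_ne hp.1 (Ne.symm h4.1)
      exact ⟨p, le_rfl, hp1, hp.2, hpq, hfine p hp1 h4.2⟩

end Numerics

/-! ### Assembly of the error and cost bounds -/

/-- The sum of both constants covers either sign of `e`, which is needed because `a₀ / s - b` may
have any sign. -/
lemma rpow_le_add_mul_rpow {c₁ c₂ a x : ℝ} (hc₁ : 0 < c₁) (ha : 0 < a) (h1 : c₁ * a ≤ x)
    (h2 : x ≤ c₂ * a) (e : ℝ) : x ^ e ≤ (c₁ ^ e + c₂ ^ e) * a ^ e := by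
  have hx : 0 < x := lt_of_lt_of_le (by positivity) h1
  have hc₂ : 0 < c₂ := pos_of_mul_pos_left (hx.trans_le h2) ha.le
  rw [add_mul, ← Real.mul_rpow hc₁.le ha.le, ← Real.mul_rpow hc₂.le ha.le]
  have p1 : 0 < (c₁ * a) ^ e := by positivity
  have p2 : 0 < (c₂ * a) ^ e := by positivity
  rcases le_total 0 e with he | he
  · have := Real.rpow_le_rpow hx.le h2 he
    linarith
  · have := Real.rpow_le_rpow_of_nonpos (by positivity) h1 he
    linarith

lemma sum_Icc_sub_pred {G : Type*} [AddCommGroup G] (f : ℕ → G) (L : ℕ) :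
    ∑ ℓ ∈ Finset.Icc 1 L, (f ℓ - f (ℓ - 1)) = f L - f 0 := by
  induction L with
  | zero => simp
  | succ n ih =>
    rw [Finset.sum_Icc_succ_top (by omega), ih]
    simp

/-- Bias-variance splitting of the error of the multilevel estimator. -/
lemma eLpNorm_sub_mlmcEstimator_le {Ω E : Type*} [MeasurableSpace Ω] {P : Measure Ω}
    [IsProbabilityMeasure P] [NormedAddCommGroup E] [NormedSpace ℝ E] {q : ℝ} (hq : 1 ≤ q)
    {m : E} {Y : ℕ → Ω → E} {ξ : ℕ → ℕ → Ω → E} (hY0 : Y 0 = 0)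
    (hY : ∀ ℓ, Integrable (Y ℓ) P) {L : ℕ} {M : ℕ → ℕ}
    (hξ : ∀ ℓ ∈ Finset.Icc 1 L, ∀ j, AEStronglyMeasurable (ξ ℓ j) P) {B : ℝ} {D : ℕ → ℝ}
    (hB : ‖m - ∫ ω, Y L ω ∂P‖ ≤ B)
    (hD0 : ∀ ℓ ∈ Finset.Icc 1 L, 0 ≤ D ℓ)
    (hD : ∀ ℓ ∈ Finset.Icc 1 L, eLpNorm (fun ω => (∫ ω', (Y ℓ ω' - Y (ℓ - 1) ω') ∂P) -
      (1 / (M ℓ : ℝ)) • ∑ j ∈ Finset.range (M ℓ), ξ ℓ j ω) (ENNReal.ofReal q) P ≤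
        ENNReal.ofReal (D ℓ)) :
    eLpNorm (fun ω => m - mlmcEstimator ξ L M ω) (ENNReal.ofReal q) P ≤
      ENNReal.ofReal (B + ∑ ℓ ∈ Finset.Icc 1 L, D ℓ) := by
  have hq1 : (1 : ℝ≥0∞) ≤ ENNReal.ofReal q := by simpa using hq
  let e : ℕ → Ω → E := fun ℓ ω => (∫ ω', (Y ℓ ω' - Y (ℓ - 1) ω') ∂P) -
      (1 / (M ℓ : ℝ)) • ∑ j ∈ Finset.range (M ℓ), ξ ℓ j ω
  have he : ∀ ℓ ∈ Finset.Icc 1 L, AEStronglyMeasurable (e ℓ) P := fun ℓ hℓ =>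
    aestronglyMeasurable_const.sub
      ((Finset.aestronglyMeasurable_fun_sum _ fun j _ => hξ ℓ hℓ j).const_smul _)
  have htel : ∑ ℓ ∈ Finset.Icc 1 L, ∫ ω, (Y ℓ ω - Y (ℓ - 1) ω) ∂P = ∫ ω, Y L ω ∂P := by
    rw [Finset.sum_congr rfl fun ℓ _ => integral_sub (hY ℓ) (hY (ℓ - 1)),
      sum_Icc_sub_pred (fun ℓ => ∫ ω, Y ℓ ω ∂P), hY0]
    simp
  have hsplit : (fun ω => m - mlmcEstimator ξ L M ω) =
      (fun _ => m - ∫ ω, Y L ω ∂P) + ∑ ℓ ∈ Finset.Icc 1 L, e ℓ := by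
    ext ω
    simp only [Pi.add_apply, Finset.sum_apply, e, Finset.sum_sub_distrib, htel, mlmcEstimator]
    abel
  have hB0 : 0 ≤ B := (norm_nonneg _).trans hB
  rw [hsplit, ENNReal.ofReal_add hB0 (Finset.sum_nonneg hD0), ENNReal.ofReal_sum_of_nonneg hD0]
  refine (eLpNorm_add_le aestronglyMeasurable_const
    (Finset.aestronglyMeasurable_sum _ he) hq1).trans (add_le_add ?_ ?_)
  · rw [eLpNorm_const _ (by positivity) (IsProbabilityMeasure.ne_zero P)]
    simp only [measure_univ, ENNReal.one_rpow, mul_one]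
    rw [← ofReal_norm]
    exact ENNReal.ofReal_le_ofReal hB
  · exact (eLpNorm_sum_le he hq1).trans (Finset.sum_le_sum hD)

theorem mainTheorem3 (p q α β γ a₀ a₁ A Cτ Cα Cβ Cγ c₁ c₂ : ℝ)
    (hp : p ∈ Set.Icc (1 : ℝ) 2) (hq : 1 < q) (hpq : p ≤ q)
    (hα : 0 < α) (hβ : 0 < β) (hγ : 0 < γ) (ha₀ : 0 ≤ a₀) (ha₁ : 0 ≤ a₁) (hA : 1 < A)
    (hCτ : 1 ≤ Cτ) (hCα : 0 < Cα) (hCβ : 0 < Cβ) (hCγ : 0 < Cγ) (hc₁ : 0 < c₁) (hc₂ : 0 < c₂) :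
    -- the implied constant depends only on the numerical parameters above
    ∃ K : ℝ, 0 < K ∧
      ∀ (E : Type*) [NormedAddCommGroup E] [NormedSpace ℝ E] [CompleteSpace E]
        [MeasurableSpace E] [BorelSpace E]
        (Ω : Type*) [MeasurableSpace Ω] (P : Measure Ω) [IsProbabilityMeasure P]
        -- the subspaces `E_ℓ` (`ℓ ≥ 1`) of dimension `N_ℓ`
        (V : ℕ → Submodule ℝ E) (N : ℕ → ℕ)
        -- `X`, its approximations `X_ℓ`, the samples `ξ_{ℓ,j}` and the costs per sample
        (X : Ω → E) (Y : ℕ → Ω → E) (ξ : ℕ → ℕ → Ω → E) (cost : ℕ → ℝ≥0),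
        HasRademacherType E p →
        (∀ ℓ, 1 ≤ ℓ → FiniteDimensional ℝ (V ℓ)) →
        (∀ ℓ, N ℓ = Module.finrank ℝ (V ℓ)) →
        TypeConstGrowth V p a₀ a₁ Cτ →
        (∀ ℓ, 1 ≤ ℓ → V ℓ ≤ V (ℓ + 1)) →
        (∀ ℓ, 1 ≤ ℓ → c₁ * A ^ ℓ ≤ (N ℓ : ℝ) ∧ (N ℓ : ℝ) ≤ c₂ * A ^ ℓ) →
        Integrable X P →
        Y 0 = 0 →
        (∀ ℓ, 1 ≤ ℓ → MemLp (Y ℓ) (ENNReal.ofReal q) P ∧ ∀ᵐ ω ∂P, Y ℓ ω ∈ V ℓ) →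
        (∀ ℓ, 1 ≤ ℓ → ‖(∫ ω, X ω ∂P) - ∫ ω, Y ℓ ω ∂P‖ ≤ Cα * (N ℓ : ℝ) ^ (-α)) →
        (∀ ℓ, 1 ≤ ℓ →
          eLpNorm (fun ω => Y ℓ ω - (∫ ω', Y ℓ ω' ∂P)
              - (Y (ℓ - 1) ω - ∫ ω', Y (ℓ - 1) ω' ∂P)) (ENNReal.ofReal q) P
            ≤ ENNReal.ofReal (Cβ * (N ℓ : ℝ) ^ (-β))) →
        (∀ ℓ, 1 ≤ ℓ → (cost ℓ : ℝ) ≤ Cγ * (N ℓ : ℝ) ^ γ) →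
        -- for each level, `ξ_{ℓ,j}` are independent copies of `X_ℓ - X_{ℓ-1}`
        (∀ ℓ, 1 ≤ ℓ → iIndepFun (ξ ℓ) P ∧
          ∀ j, IdentDistrib (ξ ℓ j) (fun ω => Y ℓ ω - Y (ℓ - 1) ω) P P) →
        ∀ ε ∈ Set.Ioc (0 : ℝ) (1 / 2),
          ∃ (L : ℕ) (M : ℕ → ℕ), 1 ≤ L ∧ (∀ ℓ ∈ Finset.Icc 1 L, 1 ≤ M ℓ) ∧
            eLpNorm (fun ω => (∫ ω', X ω' ∂P) - mlmcEstimator ξ L M ω) (ENNReal.ofReal q) P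
              < ENNReal.ofReal ε ∧
            mlmcCost cost L M ≤ K * mlmcRate p q α β γ a₀ a₁ A ε := by
  have hq0 : 0 < q := by linarith
  have hsC := sampleConst_pos hq0
  have hCτ0 : 0 < Cτ := by linarith
  have hA0 : 0 < A := by linarith
  set b := β + a₁ with hb
  let H : ℝ → ℝ := fun s => sampleConst q * (2 * Cτ ^ (1 / s)) * Cβ *
    (c₁ ^ (a₀ / s - b) + c₂ ^ (a₀ / s - b))
  -- Both `r` and `K` are fixed from the numerical parameters alone, before any space or random
  -- variable enters.
  obtain ⟨r, hpr, hr1, hr2, hrq, K, hK, hchoice⟩ :=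
    exists_isAccurateChoice_mlmcRate (a₀ := a₀) (H₁ := Cα * (c₁ ^ (-α) + c₂ ^ (-α))) (H := H)
      (G := Cγ * (c₁ ^ γ + c₂ ^ γ)) hp hq hpq hα hβ hγ ha₁ hA (by positivity)
      (fun s => by positivity) (by positivity)
  refine ⟨K, hK, ?_⟩
  intro E _ _ _ _ _ Ω _ P _ V N X Y ξ cost _ hfin hN hgrowth hnest hNA hX hY0 hY hbias hvar hcost
    hξ ε hε
  obtain ⟨L, M, hL, hM, herr, hM_cost⟩ := hchoice ε hε
  set s := r.conjExponent with hs
  have hs1 : 1 - 1 / r = 1 / s := by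
    rw [hs, Real.conjExponent]
    have : r - 1 ≠ 0 := by linarith
    field_simp
  have hq1 : (1 : ℝ≥0∞) ≤ ENNReal.ofReal q := by simpa using hq.le
  have hYmem : ∀ ℓ, MemLp (Y ℓ) (ENNReal.ofReal q) P := fun ℓ => by
    rcases Nat.eq_zero_or_pos ℓ with rfl | h
    · rw [hY0]
      exact MemLp.zero
    · exact (hY ℓ h).1
  have hYint : ∀ ℓ, Integrable (Y ℓ) P := fun ℓ => (hYmem ℓ).integrable hq1
  have hN0 : ∀ ℓ, 1 ≤ ℓ → (0 : ℝ) < N ℓ := fun ℓ hℓ =>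
    lt_of_lt_of_le (by positivity) (hNA ℓ hℓ).1
  have hNpow : ∀ ℓ, 1 ≤ ℓ → ∀ e : ℝ, (N ℓ : ℝ) ^ e ≤ (c₁ ^ e + c₂ ^ e) * (A ^ ℓ) ^ e :=
    fun ℓ hℓ => rpow_le_add_mul_rpow hc₁ (by positivity) (hNA ℓ hℓ).1 (hNA ℓ hℓ).2
  refine ⟨L, M, hL, fun ℓ _ => hM ℓ, ?_, ?_⟩
  · refine lt_of_le_of_lt (eLpNorm_sub_mlmcEstimator_le hq.le hY0 hYint ?_ ?_ ?_ ?_)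
      ((ENNReal.ofReal_lt_ofReal_iff hε.1).mpr herr)
    · intro ℓ hℓ j
      have hℓ1 := (Finset.mem_Icc.mp hℓ).1
      exact (((hξ ℓ hℓ1).2 j).memLp_iff.mpr ((hYmem ℓ).sub (hYmem (ℓ - 1)))).1
    · refine (hbias L hL).trans ?_
      rw [mul_assoc]
      gcongr
      exact hNpow L hL _
    · intro ℓ _
      positivity
    · intro ℓ hℓ
      have hℓ1 := (Finset.mem_Icc.mp hℓ).1
      have := hfin ℓ hℓ1
      have hNℓ := hN0 ℓ hℓ1
      obtain ⟨τ, hτ1, hτ, hτle⟩ := hgrowth.exists_rademacherTypeIneq hCτ hℓ1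
        (by rw [← hN ℓ]; exact_mod_cast hNℓ) hpr hr1 hr2
      rw [← hN ℓ, ← hs] at hτle
      -- Nestedness puts `Y (ℓ - 1)` into `V ℓ`; on level 1 the predecessor is `Y 0 = 0`, so nothing
      -- about `V 0` is needed.
      have hZV : ∀ᵐ ω ∂P, Y ℓ ω - Y (ℓ - 1) ω ∈ V ℓ := by
        rcases hℓ1.eq_or_lt with rfl | h1
        · filter_upwards [(hY 1 le_rfl).2] with ω hω
          simpa [hY0] using hω
        · obtain ⟨k, rfl⟩ : ∃ k, ℓ = k + 1 := ⟨ℓ - 1, by omega⟩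
          have hk : 1 ≤ k := by omega
          filter_upwards [(hY (k + 1) hℓ1).2, (hY k hk).2] with ω h2 h3
          exact (V (k + 1)).sub_mem h2 (hnest k hk h3)
      have hZD : eLpNorm (fun ω => (Y ℓ ω - Y (ℓ - 1) ω) - ∫ ω', (Y ℓ ω' - Y (ℓ - 1) ω') ∂P)
          (ENNReal.ofReal q) P ≤ ENNReal.ofReal (Cβ * (N ℓ : ℝ) ^ (-β)) := by
        refine le_of_eq_of_le ?_ (hvar ℓ hℓ1)
        congr 1
        ext ω
        rw [integral_sub (hYint ℓ) (hYint (ℓ - 1))]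
        abel
      refine (hτ.eLpNorm_sub_sampleMean_le hτ1 hr1.le hr2 hrq (by positivity)
        ((hYmem ℓ).sub (hYmem (ℓ - 1))) hZV hZD (hξ ℓ hℓ1).1 (hξ ℓ hℓ1).2 (hM ℓ)).trans
        (ENNReal.ofReal_le_ofReal ?_)
      rw [hs1]
      refine mul_le_mul_of_nonneg_right ?_ (by positivity)
      calc sampleConst q * τ * (Cβ * (N ℓ : ℝ) ^ (-β))
          ≤ sampleConst q * (2 * Cτ ^ (1 / s) * (N ℓ : ℝ) ^ (a₀ / s - a₁)) *
            (Cβ * (N ℓ : ℝ) ^ (-β)) := by gcongr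
        _ = sampleConst q * (2 * Cτ ^ (1 / s)) * Cβ * (N ℓ : ℝ) ^ (a₀ / s - b) := by
            rw [show a₀ / s - b = (a₀ / s - a₁) + -β by rw [hb]; ring, Real.rpow_add hNℓ]
            ring
        _ ≤ sampleConst q * (2 * Cτ ^ (1 / s)) * Cβ *
            ((c₁ ^ (a₀ / s - b) + c₂ ^ (a₀ / s - b)) * (A ^ ℓ) ^ (a₀ / s - b)) := by
            gcongr
            exact hNpow ℓ hℓ1 _
        _ = H s * (A ^ ℓ) ^ (a₀ / s - b) := by
            simp only [H]
            ring
  · refine le_trans ?_ hM_cost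
    refine Finset.sum_le_sum fun ℓ hℓ => ?_
    have hℓ1 := (Finset.mem_Icc.mp hℓ).1
    gcongr
    refine (hcost ℓ hℓ1).trans ?_
    rw [mul_assoc]
    gcongr
    exact hNpow ℓ hℓ1 _
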